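/- **Setting.** Let $\mathcal X$ be a non-empty set of features, $\mathcal Y$ a finite set of labels and $\tilde{\mathcal Y}$ a finite set of noisy observations, each of the last two with at least two elements. Let $\mathcal D(\tilde{\mathcal Y})$ be the set of probability distributions on $\tilde{\mathcal Y}$, and let a noise kernel $\mathcal K$ assign to each $(x,y)\in\mathcal X\times\mathcal Y$ a non-empty set $\mathcal Q^x_y\subseteq\mathcal D(\tilde{\mathcal Y})$. Put $H^2(p,q)=\sum_{m}(\sqrt{p[m]}-\sqrt{q[m]})^2$ and $H^2(\mathcal P,\mathcal Q)=\inf_{p\in\mathcal P,\,q\in\mathcal Q}H^2(p,q)$. The kernel is *well-separated* at scale $\gamma>0$ if $H^2(\mathcal Q^x_y,\mathcal Q^x_{y'})\ge\gamma$ for all $x\in\mathcal X$ and all $y\ne y'$ in $\mathcal Y$. Logarithms are natural. Fix a horizon $T$. Nature picks a ground truth $h$ in a class $\mathcal H\subseteq\mathcal Y^{\mathcal X}$. In round $t\le T$ a feature $x_t\in\mathcal X$ is chosen as a function $\psi_t$ of the past noisy labels $\tilde y_1,\dots,\tilde y_{t-1}$; a predictor $\Phi$ (a randomized strategy of the learner)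 draws $\hat y_t\sim\Phi(x_1,\dots,x_t,\tilde y_1,\dots,\tilde y_{t-1})\in\mathcal D(\mathcal Y)$, with independent randomness in different rounds; then an adversary chooses, depending on $\tilde y_1,\dots,\tilde y_{t-1}$, a distribution $\tilde p_t\in\mathcal Q^{x_t}_{h(x_t)}$, and $\tilde y_t\sim\tilde p_t$ is revealed. The cumulative error is $\sum_{t=1}^T 1\{h(x_t)\neq\hat y_t\}$. * The *high probability minimax risk* $B^\delta_T(\mathcal H,\mathcal K)$ is the infimum of all $b\ge 0$ for which there is a predictor $\Phi$ such that, for every $h\in\mathcal H$ and every choice of $(\psi_t)_t$ and $(\tilde p_t)_t$ as above, $\Pr\big[\sum_{t=1}^T1\{h(x_t)\ne\hat y_t\}\ge b\big]\le\delta$. * The *expected minimax risk* is $$\tilde r_T(\mathcal H,\mathcal K)=\inf_\Phi\ \sup_{h\in\mathcal H}\ \sup_{x_1}\sup_{\tilde p_1\in\mathcal Q^{x_1}_{h(x_1)}}\mathbb E_{\tilde y_1\sim\tilde p_1}\cdots\sup_{x_T}\sup_{\tilde p_T\in\mathcal Q^{x_T}_{h(x_T)}}\mathbb E_{\tilde y_T\sim\tilde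 p_T}\ \mathbb E_{\hat y_1,\dots,\hat y_T}\Big[\sum_{t=1}^T1\{h(x_t)\ne\hat y_t\}\Big].$$ **Theorem.** 1. *(Upper bound.)* Suppose that all sets $\mathcal Q^x_y$ are convex and closed and that $\mathcal K$ is well-separated at scale $\gamma_H>0$ with respect to $H^2$. Let $\mathcal H\subseteq\mathcal Y^{\mathcal X}$ be a finite class of size $K\ge 1$, let $0<\delta\le 1$, and let $T$ be any horizon. Then $$B^\delta_T(\mathcal H,\mathcal K)\le\frac{8\log(4K/\delta)\log K}{\gamma_H}+\log(2/\delta).$$ 2. *(Lower bound.)* There is an absolute constant $c>0$ with the following property. Let $\mathcal K$ be any kernel, $\gamma_H>0$, and $K\ge1$ an integer such that $\mathcal Y^{\mathcal X}$ has at least $K$ elements. Suppose that there are at least $\log K$ distinct features $x$ for which some labels $y\ne y'$ satisfy $H^2(\mathcal Q^x_y,\mathcal Q^x_{y'})\le\gamma_H$. Then there is a class $\mathcal H\subseteq\mathcal Y^{\mathcal X}$ of size $K$ such that, for every horizon $T\ge\log K/\gamma_H$, $$\tilde r_T(\mathcal H,\mathcal K)\ge c\,\frac{\log K}{\gamma_H}.$$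 -/

import Mathlib

namespace NoisyOnline

/-- The squared Hellinger divergence `H²(p, q) = ∑ₘ (√p[m] - √q[m])²` on a finite set. -/
noncomputable def hellingerSq {Z : Type*} [Fintype Z] (p q : Z → ℝ) : ℝ :=
  ∑ m, (Real.sqrt (p m) - Real.sqrt (q m)) ^ 2

/-- The value of a divergence between two sets of distributions, `inf_{p ∈ P, q ∈ Q} L(p, q)`.
It is only used for non-empty `P`, `Q` and non-negative `L`. -/
noncomputable def setDiv {Z : Type*} (L : (Z → ℝ) → (Z → ℝ) → ℝ) (P Q : Set (Z → ℝ)) : ℝ :=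
  sInf (Set.image2 L P Q)

/-- A noise kernel: every feature `x` and label `y` is mapped to a non-empty set `dists x y` of
probability distributions over the finite set `Z` of noisy observations. -/
structure NoiseKernel (X Y Z : Type*) [Fintype Z] where
  dists : X → Y → Set (Z → ℝ)
  dists_subset : ∀ x y, dists x y ⊆ stdSimplex ℝ Z
  dists_nonempty : ∀ x y, (dists x y).Nonempty

/-- The kernel is well-separated with respect to the divergence `L` at scale `γ`. -/
def WellSeparated {X Y Z : Type*} [Fintype Z] (L : (Z → ℝ) → (Z → ℝ) → ℝ)
    (𝒦 : NoiseKernel X Y Z) (γ : ℝ) : Prop :=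
  0 < γ ∧ ∀ (x : X) (y y' : Y), y ≠ y' → γ ≤ setDiv L (𝒦.dists x y) (𝒦.dists x y')

/-- A randomized strategy of the learner. Rounds are numbered from `0`: in round `t` the learner
has seen `t + 1` features and `t` noisy labels, and outputs a distribution over the labels. -/
abbrev Predictor (X Y Z : Type*) [Fintype Y] : Type _ :=
  (t : ℕ) → (Fin (t + 1) → X) → (Fin t → Z) → stdSimplex ℝ Y

/-- The probability that the learner's predictions are `yhat` when the features are `xs` and the
noisy labels are `ys`; the prediction of round `t` is drawn from
`Φ (x_0, …, x_t) (y_0, …, y_{t-1})`, with independent internal randomness in different rounds. -/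
noncomputable def predLaw {X Y Z : Type*} [Fintype Y] {T : ℕ} (Φ : Predictor X Y Z)
    (xs : Fin T → X) (ys : Fin T → Z) (yhat : Fin T → Y) : ℝ :=
  ∏ t : Fin T,
    (Φ t (Fin.take (t + 1) t.isLt xs) (Fin.take t t.isLt.le ys) : Y → ℝ) (yhat t)

open Classical in
/-- The cumulative error `∑ₜ 1{h(x_t) ≠ yhat_t}`. -/
noncomputable def numErrors {X Y : Type*} {T : ℕ} (h : X → Y) (xs : Fin T → X)
    (yhat : Fin T → Y) : ℝ :=
  ∑ t : Fin T, if h (xs t) ≠ yhat t then 1 else 0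

/-- The operator
`sup_{x_1} sup_{p_1 ∈ 𝒦(x_1, h(x_1))} E_{y_1 ∼ p_1} ⋯ sup_{x_T} sup_{p_T ∈ 𝒦(x_T, h(x_T))} E_{y_T ∼ p_T}`
applied to a function `F` of the features `x_1, …, x_T` and the noisy labels `y_1, …, y_T`.
It is only used for bounded `F`. -/
noncomputable def advOp {X Y Z : Type*} [Fintype Z] (𝒦 : NoiseKernel X Y Z) (h : X → Y) :
    (T : ℕ) → ((Fin T → X) → (Fin T → Z) → ℝ) → ℝ
  | 0, F => F Fin.elim0 Fin.elim0
  | T + 1, F =>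
      ⨆ x : X, ⨆ p : 𝒦.dists x (h x), ∑ y : Z, (p : Z → ℝ) y *
        advOp 𝒦 h T (fun xs ys => F (Fin.cons x xs) (Fin.cons y ys))

/-- The expected minimax risk of the class `ℋ` at horizon `T`. -/
noncomputable def expectedRisk {X Y Z : Type*} [Fintype Y] [Fintype Z]
    (ℋ : Finset (X → Y)) (𝒦 : NoiseKernel X Y Z) (T : ℕ) : ℝ :=
  ⨅ Φ : Predictor X Y Z, ⨆ h : ℋ,
    advOp 𝒦 (h : X → Y) T
      (fun xs ys => ∑ yhat : Fin T → Y, predLaw Φ xs ys yhat * numErrors (h : X → Y) xs yhat)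

/-- A strategy of Nature and the adversary against the ground truth `h`: the feature `x_t` is a
function `feature t` of the past noisy labels, and so is the conditional distribution `cond t` of
the noisy label `y_t`, which belongs to the set that the kernel assigns to `(x_t, h(x_t))`. -/
structure Adversary {X Y Z : Type*} [Fintype Z] (𝒦 : NoiseKernel X Y Z) (h : X → Y) where
  feature : (t : ℕ) → (Fin t → Z) → X
  cond : (t : ℕ) → (Fin t → Z) → (Z → ℝ)
  cond_mem : ∀ t w, cond t w ∈ 𝒦.dists (feature t w) (h (feature t w))

/-- The features of the first `T` rounds when the noisy labels are `ys`. -/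
def Adversary.features {X Y Z : Type*} [Fintype Z] {𝒦 : NoiseKernel X Y Z} {h : X → Y}
    (A : Adversary 𝒦 h) {T : ℕ} (ys : Fin T → Z) : Fin T → X :=
  fun t => A.feature t (Fin.take t t.isLt.le ys)

/-- The joint distribution of the first `T` noisy labels. -/
noncomputable def Adversary.law {X Y Z : Type*} [Fintype Z] {𝒦 : NoiseKernel X Y Z} {h : X → Y}
    (A : Adversary 𝒦 h) {T : ℕ} (ys : Fin T → Z) : ℝ :=
  ∏ t : Fin T, A.cond t (Fin.take t t.isLt.le ys) (ys t)

open Classical in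
/-- The probability, over the noisy labels and the learner's predictions, that the cumulative
error after `T` rounds is at least `b`. -/
noncomputable def errorProb {X Y Z : Type*} [Fintype Y] [Fintype Z] {𝒦 : NoiseKernel X Y Z}
    {h : X → Y} (Φ : Predictor X Y Z) (A : Adversary 𝒦 h) (T : ℕ) (b : ℝ) : ℝ :=
  ∑ ys : Fin T → Z, ∑ yhat : Fin T → Y,
    if b ≤ numErrors h (A.features ys) yhat then
      A.law ys * predLaw Φ (A.features ys) ys yhat
    else 0

/-- The high probability minimax risk of the class `ℋ` at confidence `δ` and horizon `T`: the
infimum of the numbers `b ≥ 0` such that some predictor has cumulative error at least `b` with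
probability at most `δ`, whatever the ground truth in `ℋ` and the adversary. -/
noncomputable def highProbRisk {X Y Z : Type*} [Fintype Y] [Fintype Z]
    (ℋ : Finset (X → Y)) (𝒦 : NoiseKernel X Y Z) (T : ℕ) (δ : ℝ) : ℝ :=
  sInf {b : ℝ | 0 ≤ b ∧ ∃ Φ : Predictor X Y Z,
    ∀ h ∈ ℋ, ∀ A : Adversary 𝒦 h, errorProb Φ A T b ≤ δ}

end NoisyOnline

/-! Upper bound. For convex closed sets of distributions, a maximizer of a slightly smoothed
Hellinger affinity gives, by first-order optimality, a positive weight separating the two sets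
(`exists_separating_weight`). After rescaling, each ordered pair of labels has a weight of mean at
most 1 under every law of the first label, and the weights of opposite pairs multiply to `exp γ`.
Against a ground truth `h`, the products of the weights of `(h, j)` are supermartingales, so their
sum over `j` starts at `K` and by `ville_inequality` ever reaches `K / δ` with probability at most
`δ`. Hypotheses whose sum has reached this threshold are discarded. Two survivors `i, j` have
weights with product `exp (γ · #disagreements)` below `(K / δ) ^ 2`, so they have disagreed at most
`2 log (K / δ) / γ` times. The learner takes a plurality vote of the survivors: at an error at least
half of them disagree with `h`, and the harmonic charging of `sum_card_div_card_le` bounds the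
number of such rounds.

Lower bound. The class contains a cube of labelings of about `log K` features, and each feature is
shown about `1 / (8 γ)` times in a row. Within such a block the laws of the two labels keep a large
affinity, so by Le Cam's inequality they cannot be told apart. Averaging over pairs of opposite
vertices yields a constant expected error per round (`min_le_expectedRisk`). -/

namespace NoisyOnline

/-! ### Sequential laws, Ville's inequality and the law of the predictions. -/

section SequentialLaws

variable {X Y Z : Type*}

theorem take_snoc_of_le {n m : ℕ} (h : m ≤ n) (h' : m ≤ n + 1) (w : Fin n → Z) (z : Z) :
    Fin.take m h' (Fin.snoc w z : Fin (n + 1) → Z) = Fin.take m h w := by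
  rw [← Fin.take_init m h, Fin.init_snoc]

theorem sum_snoc [Fintype Z] {n : ℕ} (F : (Fin (n + 1) → Z) → ℝ) :
    ∑ ys, F ys = ∑ w : Fin n → Z, ∑ z, F (Fin.snoc w z) := by
  rw [← (Fin.snocEquiv fun _ : Fin (n + 1) => Z).sum_comp, Fintype.sum_prod_type,
    Finset.sum_comm]
  rfl

/-- The product of the successive conditional weights `c` along a sequence. -/
noncomputable def seqLaw (c : (t : ℕ) → (Fin t → Z) → Z → ℝ) {n : ℕ} (ys : Fin n → Z) : ℝ :=
  ∏ t : Fin n, c t (Fin.take t t.isLt.le ys) (ys t)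

theorem seqLaw_snoc (c : (t : ℕ) → (Fin t → Z) → Z → ℝ) {n : ℕ} (w : Fin n → Z) (z : Z) :
    seqLaw c (Fin.snoc w z : Fin (n + 1) → Z) = seqLaw c w * c n w z := by
  unfold seqLaw
  rw [Fin.prod_univ_castSucc]
  congr 1
  · refine Finset.prod_congr rfl fun t _ => ?_
    rw [Fin.snoc_castSucc]
    exact congrArg (fun u => c t u (w t)) (take_snoc_of_le t.isLt.le _ w z)
  · rw [Fin.snoc_last]
    refine congrArg (fun u => c n u z) ?_
    exact (take_snoc_of_le le_rfl _ w z).trans (Fin.take_eq_self w)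

theorem seqLaw_nonneg {c : (t : ℕ) → (Fin t → Z) → Z → ℝ} (hc : ∀ t w z, 0 ≤ c t w z)
    {n : ℕ} (ys : Fin n → Z) : 0 ≤ seqLaw c ys :=
  Finset.prod_nonneg fun _ _ => hc _ _ _

theorem sum_seqLaw_take [Fintype Z] {c : (t : ℕ) → (Fin t → Z) → Z → ℝ}
    (hc : ∀ t w, ∑ z, c t w z = 1) {m n : ℕ} (h : m ≤ n) (g : (Fin m → Z) → ℝ) :
    ∑ ys : Fin n → Z, seqLaw c ys * g (Fin.take m h ys) = ∑ w, seqLaw c w * g w := by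
  induction n, h using Nat.le_induction with
  | base => simp only [Fin.take_eq_self]
  | succ n h ih =>
    rw [← ih, sum_snoc]
    refine Finset.sum_congr rfl fun w _ => ?_
    simp only [seqLaw_snoc, take_snoc_of_le h]
    rw [← Finset.sum_mul, ← Finset.mul_sum, hc, mul_one]

theorem sum_seqLaw [Fintype Z] {c : (t : ℕ) → (Fin t → Z) → Z → ℝ}
    (hc : ∀ t w, ∑ z, c t w z = 1) (n : ℕ) : ∑ ys : Fin n → Z, seqLaw c ys = 1 := by
  have := sum_seqLaw_take hc (Nat.zero_le n) fun _ => 1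
  simpa [seqLaw] using this

open Classical in
/-- Ville's maximal inequality for a non-negative supermartingale `M`. -/
theorem ville_inequality [Fintype Z] {c : (t : ℕ) → (Fin t → Z) → Z → ℝ}
    (hc : ∀ t w, ∑ z, c t w z = 1) (hc0 : ∀ t w z, 0 ≤ c t w z)
    (M : (t : ℕ) → (Fin t → Z) → ℝ) (hM0 : ∀ t w, 0 ≤ M t w)
    (hM : ∀ t w, ∑ z, c t w z * M (t + 1) (Fin.snoc w z) ≤ M t w) (a : ℝ) (n : ℕ) :
    a * ∑ ys : Fin n → Z,
      (if ∃ s, ∃ hs : s ≤ n, a ≤ M s (Fin.take s hs ys) then seqLaw c ys else 0)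
        ≤ M 0 Fin.elim0 := by
  let hit : (t : ℕ) → (Fin t → Z) → Prop := fun t w =>
    ∃ s, ∃ hs : s ≤ t, a ≤ M s (Fin.take s hs w)
  -- The process frozen at the value `a` once `M` has reached it; freezing preserves the
  -- supermartingale property because `M ≥ a` at the first hit.
  let N : (t : ℕ) → (Fin t → Z) → ℝ := fun t w => if hit t w then a else M t w
  have hNM : ∀ t w, N t w ≤ M t w ∨ (N t w = a ∧ hit t w) := by
    intro t w
    by_cases h : hit t w
    · exact Or.inr ⟨if_pos h, h⟩
    · exact Or.inl (if_neg h).le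
  have hsuper : ∀ t w, ∑ z, c t w z * N (t + 1) (Fin.snoc w z) ≤ N t w := by
    intro t w
    by_cases h : hit t w
    · have h1 : ∀ z, N (t + 1) (Fin.snoc w z) = a := by
        intro z
        obtain ⟨s, hs, h2⟩ := h
        refine if_pos ⟨s, by omega, ?_⟩
        rwa [take_snoc_of_le hs]
      simp only [h1, ← Finset.sum_mul, hc, one_mul]
      exact (if_pos h).ge
    · have h0 : N t w = M t w := if_neg h
      rw [h0]
      refine le_trans (Finset.sum_le_sum fun z _ => ?_) (hM t w)
      refine mul_le_mul_of_nonneg_left ?_ (hc0 t w z)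
      by_cases h1 : hit (t + 1) (Fin.snoc w z)
      · have h2 : N (t + 1) (Fin.snoc w z) = a := if_pos h1
        rw [h2]
        obtain ⟨s, hs, h3⟩ := h1
        rcases Nat.lt_or_ge t s with h4 | h4
        · obtain rfl : s = t + 1 := by omega
          rwa [Fin.take_eq_self] at h3
        · exact absurd ⟨s, h4, by rwa [take_snoc_of_le h4] at h3⟩ h
      · exact (if_neg h1).le
  have hE : ∀ n, ∑ ys : Fin n → Z, seqLaw c ys * N n ys ≤ N 0 Fin.elim0 := by
    intro n
    induction n with
    | zero =>
      rw [Fintype.sum_unique]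
      have : (default : Fin 0 → Z) = Fin.elim0 := Subsingleton.elim _ _
      simp [seqLaw, this]
    | succ n ih =>
      refine le_trans ?_ ih
      rw [sum_snoc]
      refine Finset.sum_le_sum fun w _ => ?_
      simp only [seqLaw_snoc, mul_assoc, ← Finset.mul_sum]
      exact mul_le_mul_of_nonneg_left (hsuper n w) (seqLaw_nonneg hc0 w)
  have hN0 : N 0 Fin.elim0 ≤ M 0 Fin.elim0 := by
    rcases hNM 0 Fin.elim0 with h | ⟨h, s, hs, h1⟩
    · exact h
    · obtain rfl : s = 0 := by omega
      rw [h]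
      rwa [Fin.take_eq_self] at h1
  refine le_trans ?_ ((hE n).trans hN0)
  rw [Finset.mul_sum]
  refine Finset.sum_le_sum fun ys _ => ?_
  have h0 := seqLaw_nonneg hc0 ys
  by_cases h : hit n ys
  · have h1 : N n ys = a := if_pos h
    rw [h1, if_pos h, mul_comm]
  · have h1 : N n ys = M n ys := if_neg h
    rw [h1, if_neg h, mul_zero]
    exact mul_nonneg h0 (hM0 _ _)

theorem sum_predLaw [Fintype Y] {T : ℕ} (Φ : Predictor X Y Z) (xs : Fin T → X)
    (ys : Fin T → Z) : ∑ yhat : Fin T → Y, predLaw Φ xs ys yhat = 1 := by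
  classical
  unfold predLaw
  rw [← Fintype.prod_sum fun (t : Fin T) y =>
    (Φ t (Fin.take (t + 1) t.isLt xs) (Fin.take t t.isLt.le ys) : Y → ℝ) y]
  exact Finset.prod_eq_one fun t _ => (Φ t _ _).2.2

theorem predLaw_nonneg [Fintype Y] {T : ℕ} (Φ : Predictor X Y Z) (xs : Fin T → X)
    (ys : Fin T → Z) (yhat : Fin T → Y) : 0 ≤ predLaw Φ xs ys yhat :=
  Finset.prod_nonneg fun t _ => (Φ t _ _).2.1 _

theorem sum_predLaw_mul_apply [Fintype Y] {T : ℕ} (Φ : Predictor X Y Z) (xs : Fin T → X)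
    (ys : Fin T → Z) (t : Fin T) (g : Y → ℝ) :
    ∑ yhat : Fin T → Y, predLaw Φ xs ys yhat * g (yhat t) =
      ∑ y, (Φ t (Fin.take (t + 1) t.isLt xs) (Fin.take t t.isLt.le ys) : Y → ℝ) y * g y := by
  classical
  let f : Fin T → Y → ℝ := fun s y =>
    (Φ s (Fin.take (s + 1) s.isLt xs) (Fin.take s s.isLt.le ys) : Y → ℝ) y
  have h1 : ∀ yhat : Fin T → Y, predLaw Φ xs ys yhat * g (yhat t) =
      ∏ s, f s (yhat s) * (if s = t then g (yhat s) else 1) := by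
    intro yhat
    rw [Finset.prod_mul_distrib]
    congr 1
    rw [Finset.prod_ite_eq' Finset.univ t fun s => g (yhat s)]
    simp
  simp only [h1]
  rw [← Fintype.prod_sum fun (s : Fin T) y => f s y * (if s = t then g y else 1),
    Finset.prod_eq_single t]
  · simp [f]
  · intro s _ hs
    simp only [hs, if_false, mul_one]
    exact (Φ s _ _).2.2
  · simp

end SequentialLaws

/-! ### Hellinger affinity and separating weights. -/

section Hellinger

variable {X Y Z : Type*} [Fintype Z]

theorem hellingerSq_nonneg (p q : Z → ℝ) : 0 ≤ hellingerSq p q :=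
  Finset.sum_nonneg fun _ _ => sq_nonneg _

theorem hellingerSq_eq {p q : Z → ℝ} (hp : p ∈ stdSimplex ℝ Z) (hq : q ∈ stdSimplex ℝ Z) :
    hellingerSq p q = 2 - 2 * ∑ z, Real.sqrt (p z) * Real.sqrt (q z) := by
  have h : hellingerSq p q =
      ∑ z, (p z + q z - 2 * (Real.sqrt (p z) * Real.sqrt (q z))) := by
    refine Finset.sum_congr rfl fun z _ => ?_
    rw [sub_sq, Real.sq_sqrt (hp.1 z), Real.sq_sqrt (hq.1 z)]
    ring
  rw [h, Finset.sum_sub_distrib, Finset.sum_add_distrib, hp.2, hq.2, ← Finset.mul_sum]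
  ring

theorem hellingerSq_le_two {p q : Z → ℝ} (hp : p ∈ stdSimplex ℝ Z)
    (hq : q ∈ stdSimplex ℝ Z) : hellingerSq p q ≤ 2 := by
  rw [hellingerSq_eq hp hq]
  have : 0 ≤ ∑ z, Real.sqrt (p z) * Real.sqrt (q z) :=
    Finset.sum_nonneg fun z _ => by positivity
  linarith

theorem setDiv_hellingerSq_le {P Q : Set (Z → ℝ)} {p q : Z → ℝ} (hp : p ∈ P) (hq : q ∈ Q) :
    setDiv hellingerSq P Q ≤ hellingerSq p q := by
  refine csInf_le ⟨0, ?_⟩ (Set.mem_image2_of_mem hp hq)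
  rintro _ ⟨a, -, b, -, rfl⟩
  exact hellingerSq_nonneg a b

theorem WellSeparated.le_two [Nonempty X] [Nontrivial Y] {𝒦 : NoiseKernel X Y Z} {γ : ℝ}
    (h : WellSeparated hellingerSq 𝒦 γ) : γ ≤ 2 := by
  obtain ⟨y, y', hy⟩ := exists_pair_ne Y
  obtain ⟨x⟩ := ‹Nonempty X›
  obtain ⟨p, hp⟩ := 𝒦.dists_nonempty x y
  obtain ⟨q, hq⟩ := 𝒦.dists_nonempty x y'
  exact (h.2 x y y' hy).trans ((setDiv_hellingerSq_le hp hq).trans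
    (hellingerSq_le_two (𝒦.dists_subset x y hp) (𝒦.dists_subset x y' hq)))

/-- First-order optimality for the affinity `∑ √(a b)` in the direction `v`. -/
theorem sum_mul_sqrt_div_sqrt_nonpos {a b v : Z → ℝ} (ha : ∀ z, 0 < a z) (hb : ∀ z, 0 < b z)
    (h : ∀ t ∈ Set.Ioc (0 : ℝ) 1,
      ∑ z, Real.sqrt ((a z + t * v z) * b z) ≤ ∑ z, Real.sqrt (a z * b z)) :
    ∑ z, v z * (Real.sqrt (b z) / Real.sqrt (a z)) ≤ 0 := by
  have hd : HasDerivAt (fun t : ℝ => ∑ z, Real.sqrt ((a z + t * v z) * b z))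
      (∑ z, v z * b z / (2 * Real.sqrt (a z * b z))) 0 := by
    refine HasDerivAt.fun_sum fun z _ => ?_
    have h1 : HasDerivAt (fun t : ℝ => (a z + t * v z) * b z) (v z * b z) 0 := by
      have := (((hasDerivAt_id (0 : ℝ)).mul_const (v z)).const_add (a z)).mul_const (b z)
      simpa using this
    have h2 := h1.sqrt (by simpa using (mul_pos (ha z) (hb z)).ne')
    simpa using h2
  have hlim := hd.tendsto_slope_zero_right
  have h0 : ∑ z, v z * b z / (2 * Real.sqrt (a z * b z)) ≤ 0 := by
    refine le_of_tendsto hlim ?_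
    filter_upwards [Ioc_mem_nhdsGT (zero_lt_one' ℝ)] with t ht
    have h1 := h t ht
    simp only [zero_add, zero_mul, add_zero, smul_eq_mul]
    exact mul_nonpos_of_nonneg_of_nonpos (inv_nonneg.2 ht.1.le) (by linarith)
  have h1 : ∑ z, v z * (Real.sqrt (b z) / Real.sqrt (a z)) =
      2 * ∑ z, v z * b z / (2 * Real.sqrt (a z * b z)) := by
    rw [Finset.mul_sum]
    refine Finset.sum_congr rfl fun z _ => ?_
    have h2 := Real.sqrt_pos.2 (ha z)
    have h3 := Real.sqrt_pos.2 (hb z)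
    rw [Real.sqrt_mul (ha z).le]
    nth_rewrite 2 [← Real.mul_self_sqrt (hb z).le]
    field_simp
  linarith

/-- Convexity makes `p - p₀` an admissible direction, so the derivative of the affinity along it is
nonpositive at the maximizer `p₀`. The shift `e` keeps all coordinates positive, hence the square
roots differentiable. -/
theorem sum_mul_sqrt_div_sqrt_le {P : Set (Z → ℝ)} (hP : P ⊆ stdSimplex ℝ Z)
    (hconv : Convex ℝ P) {e : ℝ} (he : 0 < e) {b p₀ : Z → ℝ} (hb : ∀ z, 0 < b z)
    (hp₀ : p₀ ∈ P)
    (hmax : ∀ p ∈ P, ∑ z, Real.sqrt ((p z + e) * b z) ≤ ∑ z, Real.sqrt ((p₀ z + e) * b z))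
    {p : Z → ℝ} (hp : p ∈ P) :
    ∑ z, p z * (Real.sqrt (b z) / Real.sqrt (p₀ z + e)) ≤
      ∑ z, Real.sqrt ((p₀ z + e) * b z) := by
  have ha : ∀ z, 0 < p₀ z + e := fun z => add_pos_of_nonneg_of_pos ((hP hp₀).1 z) he
  have h1 := sum_mul_sqrt_div_sqrt_nonpos (v := fun z => p z - p₀ z) ha hb (by
    intro t ht
    have h2 := hmax ((1 - t) • p₀ + t • p)
      (hconv hp₀ hp (by linarith [ht.2]) ht.1.le (by ring))
    convert h2 using 4 with z
    simp only [Pi.add_apply, Pi.smul_apply, smul_eq_mul]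
    ring)
  have h3 : ∑ z, p z * (Real.sqrt (b z) / Real.sqrt (p₀ z + e)) ≤
      ∑ z, (p z + e) * (Real.sqrt (b z) / Real.sqrt (p₀ z + e)) := by
    refine Finset.sum_le_sum fun z _ => mul_le_mul_of_nonneg_right (by linarith) ?_
    positivity
  refine h3.trans ?_
  have h4 : ∑ z, (p z + e) * (Real.sqrt (b z) / Real.sqrt (p₀ z + e)) =
      ∑ z, (p z - p₀ z) * (Real.sqrt (b z) / Real.sqrt (p₀ z + e)) +
        ∑ z, Real.sqrt ((p₀ z + e) * b z) := by
    rw [← Finset.sum_add_distrib]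
    refine Finset.sum_congr rfl fun z _ => ?_
    have h5 := Real.sqrt_pos.2 (ha z)
    have h6 : Real.sqrt (p₀ z + e) * Real.sqrt (b z) =
        (p₀ z + e) * (Real.sqrt (b z) / Real.sqrt (p₀ z + e)) := by
      nth_rewrite 2 [← Real.mul_self_sqrt (ha z).le]
      field_simp
    rw [Real.sqrt_mul (ha z).le, h6]
    ring
  linarith

theorem sum_sqrt_add_mul_add_le {p q : Z → ℝ} (hp : p ∈ stdSimplex ℝ Z)
    (hq : q ∈ stdSimplex ℝ Z) {η : ℝ} (hη : 0 ≤ η) (hη1 : η ≤ 1) :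
    ∑ z, Real.sqrt ((p z + η ^ 2) * (q z + η ^ 2)) ≤
      ∑ z, Real.sqrt (p z) * Real.sqrt (q z) + 3 * Fintype.card Z * η := by
  have key : ∀ r ∈ stdSimplex ℝ Z, ∀ z, Real.sqrt (r z + η ^ 2) ≤ Real.sqrt (r z) + η ∧
      Real.sqrt (r z) ≤ 1 := by
    intro r hr z
    constructor
    · rw [Real.sqrt_le_left (by positivity), add_sq, Real.sq_sqrt (hr.1 z)]
      have := mul_nonneg (Real.sqrt_nonneg (r z)) hη
      linarith
    · refine Real.sqrt_le_one.2 ?_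
      exact (Finset.single_le_sum (fun z _ => hr.1 z) (Finset.mem_univ z)).trans_eq hr.2
  have h1 : ∀ z, Real.sqrt ((p z + η ^ 2) * (q z + η ^ 2)) ≤
      Real.sqrt (p z) * Real.sqrt (q z) + 3 * η := by
    intro z
    rw [Real.sqrt_mul (add_nonneg (hp.1 z) (sq_nonneg η))]
    obtain ⟨h2, h3⟩ := key p hp z
    obtain ⟨h4, h5⟩ := key q hq z
    have h6 := mul_le_mul h2 h4 (Real.sqrt_nonneg _) (by positivity)
    have h7 := mul_le_mul_of_nonneg_right h3 hη
    have h8 := mul_le_mul_of_nonneg_right h5 hη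
    have h9 := mul_le_mul_of_nonneg_right hη1 hη
    linarith
  refine (Finset.sum_le_sum fun z _ => h1 z).trans_eq ?_
  rw [Finset.sum_add_distrib, Finset.sum_const, Finset.card_univ, nsmul_eq_mul]
  ring

/-- Two convex closed sets of distributions with Hellinger distance `γ` are separated by a
positive weight: its mean is at most `exp (-γ / 2)` under each element of the first set, and so
is the mean of its inverse under each element of the second. -/
theorem exists_separating_weight {P Q : Set (Z → ℝ)} (hP : P ⊆ stdSimplex ℝ Z)
    (hQ : Q ⊆ stdSimplex ℝ Z) (hPn : P.Nonempty) (hQn : Q.Nonempty) (hPconv : Convex ℝ P)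
    (hQconv : Convex ℝ Q) (hPcl : IsClosed P) (hQcl : IsClosed Q) {γ : ℝ} (hγ : 0 < γ)
    (h : ∀ p ∈ P, ∀ q ∈ Q, γ ≤ hellingerSq p q) :
    ∃ φ : Z → ℝ, (∀ z, 0 < φ z) ∧ (∀ p ∈ P, ∑ z, p z * φ z ≤ Real.exp (-γ / 2)) ∧
      ∀ q ∈ Q, ∑ z, q z * (φ z)⁻¹ ≤ Real.exp (-γ / 2) := by
  have hr : 1 - γ / 2 < Real.exp (-γ / 2) := by
    have := Real.add_one_lt_exp (x := -γ / 2) (by linarith)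
    linarith
  let N : ℝ := 3 * Fintype.card Z
  have hN : 0 ≤ N := by positivity
  -- The smoothing raises the affinity, at most `1 - γ / 2`, by at most `N * η`; the strict gap
  -- between `1 - γ / 2` and `exp (-γ / 2)` pays for it.
  let η : ℝ := min 1 ((Real.exp (-γ / 2) - (1 - γ / 2)) / (N + 1))
  have hη : 0 < η := lt_min one_pos (div_pos (by linarith) (by linarith))
  have hη1 : η ≤ 1 := min_le_left _ _
  have hηN : N * η ≤ Real.exp (-γ / 2) - (1 - γ / 2) := by
    have h1 : η ≤ (Real.exp (-γ / 2) - (1 - γ / 2)) / (N + 1) := min_le_right _ _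
    rw [le_div_iff₀ (by linarith)] at h1
    linarith
  have hcomp : IsCompact (P ×ˢ Q) :=
    ((isCompact_stdSimplex ℝ Z).of_isClosed_subset hPcl hP).prod
      ((isCompact_stdSimplex ℝ Z).of_isClosed_subset hQcl hQ)
  have hcont : Continuous fun r : (Z → ℝ) × (Z → ℝ) =>
      ∑ z, Real.sqrt ((r.1 z + η ^ 2) * (r.2 z + η ^ 2)) := by fun_prop
  obtain ⟨⟨p₀, q₀⟩, ⟨hp₀, hq₀⟩, hmax⟩ :=
    hcomp.exists_isMaxOn (hPn.prod hQn) hcont.continuousOn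
  have hη2 : 0 < η ^ 2 := by positivity
  have hp₀' : ∀ z, 0 < p₀ z + η ^ 2 := fun z => add_pos_of_nonneg_of_pos ((hP hp₀).1 z) hη2
  have hq₀' : ∀ z, 0 < q₀ z + η ^ 2 := fun z => add_pos_of_nonneg_of_pos ((hQ hq₀).1 z) hη2
  have hbound : ∑ z, Real.sqrt ((p₀ z + η ^ 2) * (q₀ z + η ^ 2)) ≤ Real.exp (-γ / 2) := by
    have h1 := sum_sqrt_add_mul_add_le (hP hp₀) (hQ hq₀) hη.le hη1
    have h2 := h p₀ hp₀ q₀ hq₀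
    rw [hellingerSq_eq (hP hp₀) (hQ hq₀)] at h2
    linarith
  refine ⟨fun z => Real.sqrt (q₀ z + η ^ 2) / Real.sqrt (p₀ z + η ^ 2), fun z =>
    div_pos (Real.sqrt_pos.2 (hq₀' z)) (Real.sqrt_pos.2 (hp₀' z)), fun p hp => ?_,
    fun q hq => ?_⟩
  · exact (sum_mul_sqrt_div_sqrt_le hP hPconv hη2 hq₀' hp₀
      (fun p hp => hmax (Set.mk_mem_prod hp hq₀)) hp).trans hbound
  · simp only [inv_div]
    refine (sum_mul_sqrt_div_sqrt_le hQ hQconv hη2 hp₀' hq₀ (fun q hq => ?_) hq).trans ?_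
    · have h1 : ∑ z, Real.sqrt ((p₀ z + η ^ 2) * (q z + η ^ 2)) ≤
          ∑ z, Real.sqrt ((p₀ z + η ^ 2) * (q₀ z + η ^ 2)) := hmax (Set.mk_mem_prod hp₀ hq)
      simpa only [mul_comm] using h1
    · simpa only [mul_comm] using hbound

/-- For each pair of labels there is a weight of mean at most `1` under the distributions of the
first label, and the weights of a pair of labels and of the reversed pair multiply to `exp γ`. -/
theorem WellSeparated.exists_weights [Fintype Y] {𝒦 : NoiseKernel X Y Z} {γ : ℝ}
    (hsep : WellSeparated hellingerSq 𝒦 γ) (hconv : ∀ x y, Convex ℝ (𝒦.dists x y))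
    (hcl : ∀ x y, IsClosed (𝒦.dists x y)) :
    ∃ w : X → Y → Y → Z → ℝ, (∀ x y y' z, 0 < w x y y' z) ∧
      (∀ x y z, w x y y z = 1) ∧
      (∀ x y y' z, y ≠ y' → w x y y' z * w x y' y z = Real.exp γ) ∧
      ∀ x y y', ∀ p ∈ 𝒦.dists x y, ∑ z, p z * w x y y' z ≤ 1 := by
  have hex : ∀ x y y', ∃ φ : Z → ℝ, (∀ z, 0 < φ z) ∧ (y ≠ y' →
      (∀ p ∈ 𝒦.dists x y, ∑ z, p z * φ z ≤ Real.exp (-γ / 2)) ∧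
      ∀ q ∈ 𝒦.dists x y', ∑ z, q z * (φ z)⁻¹ ≤ Real.exp (-γ / 2)) := by
    intro x y y'
    by_cases hy : y = y'
    · exact ⟨fun _ => 1, fun _ => one_pos, fun h => absurd hy h⟩
    · obtain ⟨φ, h1, h2⟩ := exists_separating_weight (𝒦.dists_subset x y)
        (𝒦.dists_subset x y') (𝒦.dists_nonempty x y) (𝒦.dists_nonempty x y') (hconv x y)
        (hconv x y') (hcl x y) (hcl x y') hsep.1
        (fun p hp q hq => (hsep.2 x y y' hy).trans (setDiv_hellingerSq_le hp hq))
      exact ⟨φ, h1, fun _ => h2⟩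
  choose φ hφ0 hφ using hex
  let e := Fintype.equivFin Y
  have hexp : Real.exp (γ / 2) * Real.exp (-γ / 2) = 1 := by
    rw [← Real.exp_add]
    ring_nf
    exact Real.exp_zero
  have hexp2 : Real.exp (γ / 2) * Real.exp (γ / 2) = Real.exp γ := by
    rw [← Real.exp_add]
    ring_nf
  have hmean : ∀ (p f : Z → ℝ), ∑ z, p z * f z ≤ Real.exp (-γ / 2) →
      ∑ z, p z * (Real.exp (γ / 2) * f z) ≤ 1 := by
    intro p f hpf
    have h1 := mul_le_mul_of_nonneg_left hpf (Real.exp_pos (γ / 2)).le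
    rw [hexp, Finset.mul_sum] at h1
    refine le_trans (le_of_eq ?_) h1
    exact Finset.sum_congr rfl fun z _ => by ring
  -- The enumeration of the labels orients each pair, so that both orders use the same `φ`, once
  -- directly and once inverted; hence the product is exactly `exp γ`.
  refine ⟨fun x y y' z => if e y < e y' then Real.exp (γ / 2) * φ x y y' z
    else if e y' < e y then Real.exp (γ / 2) * (φ x y' y z)⁻¹ else 1, ?_, ?_, ?_, ?_⟩
  · intro x y y' z
    have h1 := hφ0 x y y' z
    have h2 := hφ0 x y' y z
    dsimp only
    split_ifs <;> positivity
  · intro x y z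
    simp
  · intro x y y' z hy
    rcases lt_trichotomy (e y) (e y') with h1 | h1 | h1
    · have := (hφ0 x y y' z).ne'
      simp only [h1, h1.not_gt, if_true, if_false]
      rw [← hexp2]
      field_simp
    · exact absurd (e.injective h1) hy
    · have := (hφ0 x y' y z).ne'
      simp only [h1, h1.not_gt, if_true, if_false]
      rw [← hexp2]
      field_simp
  · intro x y y' p hp
    rcases lt_trichotomy (e y) (e y') with h1 | h1 | h1
    · simp only [h1, if_true]
      exact hmean p _ ((hφ x y y' fun h => h1.ne (congrArg e h)).1 p hp)
    · simp only [h1, lt_irrefl, if_false, mul_one]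
      exact (𝒦.dists_subset x y hp).2.le
    · simp only [h1, h1.not_gt, if_true, if_false]
      exact hmean p _ ((hφ x y' y fun h => h1.ne (congrArg e h)).2 p hp)

end Hellinger

/-! ### Harmonic charging for shrinking sets of hypotheses. -/

section Elimination

/-- Removing successively an element with large `f` compares the sum with `1/2 + 1/3 + ⋯ + 1/(|S| +
1)`. -/
theorem sum_one_div_le_log {ι : Type*} (S : Finset ι) (f : ι → ℝ)
    (hf : ∀ S' ⊆ S, S'.Nonempty → ∃ i ∈ S', (S'.card : ℝ) + 1 ≤ f i) :
    ∑ i ∈ S, 1 / f i ≤ Real.log (S.card + 1) := by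
  classical
  induction hn : S.card generalizing S with
  | zero =>
    rw [Finset.card_eq_zero] at hn
    simp [hn]
  | succ n ih =>
    obtain ⟨i, hi, hfi⟩ := hf S subset_rfl (Finset.card_pos.1 (by omega))
    have h1 := ih (S.erase i) (fun S' hS' => hf S' (hS'.trans (Finset.erase_subset i S)))
      (by rw [Finset.card_erase_of_mem hi, hn]; rfl)
    rw [← Finset.add_sum_erase S _ hi]
    rw [hn] at hfi
    push_cast at hfi ⊢
    have hn0 : (0 : ℝ) ≤ n := Nat.cast_nonneg n
    have h2 : 1 / f i ≤ 1 / ((n : ℝ) + 2) := one_div_le_one_div_of_le (by linarith) (by linarith)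
    have h3 := Real.one_sub_inv_le_log_of_pos (x := ((n : ℝ) + 2) / (n + 1)) (by positivity)
    rw [Real.log_div (by positivity) (by positivity), inv_div] at h3
    have h4 : 1 - ((n : ℝ) + 1) / (n + 2) = 1 / (n + 2) := by field_simp; ring
    have h5 : (n : ℝ) + 1 + 1 = n + 2 := by ring
    rw [h5]
    linarith

/-- If `D t` is a part of the decreasing sets `A t`, each element belongs to at most `N` of the
sets `D t`, and one element of all `A t` belongs to none of them, then the sum of the ratios
`|D t| / |A t|` is at most `N log |H|`. -/
theorem sum_card_div_card_le {ι : Type*} {T : ℕ} {A D : Fin T → Finset ι} {H : Finset ι}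
    {i₀ : ι} {N : ℝ} (hN : 0 ≤ N) (hA : Antitone A) (hAH : ∀ t, A t ⊆ H)
    (hDA : ∀ t, D t ⊆ A t) (hi₀ : ∀ t, i₀ ∈ A t) (hi₀' : ∀ t, i₀ ∉ D t)
    (hcard : ∀ i ∈ H, ∀ E : Finset (Fin T), (∀ t ∈ E, i ∈ D t) → (E.card : ℝ) ≤ N) :
    ∑ t, ((D t).card : ℝ) / (A t).card ≤ N * Real.log H.card := by
  classical
  rcases Nat.eq_zero_or_pos T with rfl | hT
  · simpa using mul_nonneg hN (Real.log_natCast_nonneg _)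
  let S := H.filter fun i => ∃ t, i ∈ D t
  have hlast : ∀ i ∈ S, ∃ τ : Fin T, i ∈ D τ ∧ ∀ t, i ∈ D t → t ≤ τ := by
    intro i hi
    obtain ⟨t, ht⟩ := (Finset.mem_filter.1 hi).2
    have hne : (Finset.univ.filter fun t => i ∈ D t).Nonempty := ⟨t, by simpa using ht⟩
    refine ⟨Finset.max' _ hne, ?_, fun t ht => Finset.le_max' _ t (by simpa using ht)⟩
    simpa using Finset.max'_mem _ hne
  have : Nonempty (Fin T) := ⟨⟨0, hT⟩⟩
  choose! τ hτ hτ' using hlast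
  have hlog : ∑ i ∈ S, 1 / ((A (τ i)).card : ℝ) ≤ Real.log (S.card + 1) := by
    refine sum_one_div_le_log S _ fun S' hS' hne => ?_
    obtain ⟨i, hi, hmin⟩ := S'.exists_min_image τ hne
    refine ⟨i, hi, ?_⟩
    -- `i` has the earliest last occurrence `τ` in `S'`, so all of `S'` still lies in `A (τ i)`; the
    -- permanent element `i₀` supplies the extra `+ 1`.
    have hsub : insert i₀ S' ⊆ A (τ i) := by
      intro j hj
      rcases Finset.mem_insert.1 hj with rfl | hj
      · exact hi₀ _
      · exact hA (hmin j hj) (hDA _ (hτ j (hS' hj)))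
    have hnot : i₀ ∉ S' := fun hj => hi₀' _ (hτ i₀ (hS' hj))
    have := Finset.card_le_card hsub
    rw [Finset.card_insert_of_notMem hnot] at this
    exact_mod_cast this
  have hSH : (S.card : ℝ) + 1 ≤ H.card := by
    have hsub : insert i₀ S ⊆ H := by
      intro j hj
      rcases Finset.mem_insert.1 hj with rfl | hj
      · exact hAH ⟨0, hT⟩ (hi₀ _)
      · exact (Finset.mem_filter.1 hj).1
    have hnot : i₀ ∉ S := fun hj => hi₀' _ (hτ i₀ hj)
    have := Finset.card_le_card hsub
    rw [Finset.card_insert_of_notMem hnot] at this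
    exact_mod_cast this
  have hD : ∀ t, ((D t).card : ℝ) / (A t).card =
      ∑ i ∈ S, if i ∈ D t then 1 / ((A t).card : ℝ) else 0 := by
    intro t
    rw [← Finset.sum_filter, Finset.sum_const, nsmul_eq_mul, mul_one_div]
    congr 3
    ext i
    simp only [S, Finset.mem_filter]
    exact ⟨fun h => ⟨⟨hAH t (hDA t h), t, h⟩, h⟩, fun h => h.2⟩
  calc ∑ t, ((D t).card : ℝ) / (A t).card
      = ∑ i ∈ S, ∑ t, if i ∈ D t then 1 / ((A t).card : ℝ) else 0 := by
        rw [Finset.sum_comm]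
        exact Finset.sum_congr rfl fun t _ => hD t
    _ ≤ ∑ i ∈ S, N * (1 / ((A (τ i)).card : ℝ)) := by
        refine Finset.sum_le_sum fun i hi => ?_
        -- Every charge to `i` is at most the one at its last occurrence, since the sets `A t` only
        -- shrink.
        have h1 : ∀ t, (if i ∈ D t then 1 / ((A t).card : ℝ) else 0) ≤
            if i ∈ D t then 1 / ((A (τ i)).card : ℝ) else 0 := by
          intro t
          split_ifs with h
          · refine one_div_le_one_div_of_le ?_ ?_
            · exact_mod_cast Finset.card_pos.2 ⟨i₀, hi₀ _⟩
            · exact_mod_cast Finset.card_le_card (hA (hτ' i hi t h))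
          · exact le_rfl
        refine (Finset.sum_le_sum fun t _ => h1 t).trans ?_
        rw [← Finset.sum_filter, Finset.sum_const, nsmul_eq_mul]
        refine mul_le_mul_of_nonneg_right ?_ (by positivity)
        exact hcard i (Finset.mem_filter.1 hi).1 _ fun t ht => (Finset.mem_filter.1 ht).2
    _ ≤ N * Real.log H.card := by
        rw [← Finset.mul_sum]
        refine mul_le_mul_of_nonneg_left (hlog.trans ?_) hN
        exact Real.log_le_log (by positivity) hSH

end Elimination

/-! ### The elimination predictor and the upper bound. -/

section Upper

variable {X Y Z : Type*}

/-- The likelihood-type weight of the pair `i, j` along a sequence of features and labels. -/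
noncomputable def pairWeight (w : X → Y → Y → Z → ℝ) (i j : X → Y) {n : ℕ} (xs : Fin n → X)
    (ys : Fin n → Z) : ℝ :=
  ∏ s : Fin n, w (xs s) (i (xs s)) (j (xs s)) (ys s)

noncomputable def score (w : X → Y → Y → Z → ℝ) (ℋ : Finset (X → Y)) (i : X → Y) {n : ℕ}
    (xs : Fin n → X) (ys : Fin n → Z) : ℝ :=
  ∑ j ∈ ℋ, pairWeight w i j xs ys

open Classical in
/-- The hypotheses whose score has remained below `a` up to time `t`. -/
noncomputable def alive (w : X → Y → Y → Z → ℝ) (ℋ : Finset (X → Y)) (a : ℝ) (t : ℕ)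
    {m n : ℕ} (hm : t ≤ m) (hn : t ≤ n) (xs : Fin m → X) (ys : Fin n → Z) : Finset (X → Y) :=
  ℋ.filter fun i => ∀ s, ∀ hs : s ≤ t,
    score w ℋ i (Fin.take s (hs.trans hm) xs) (Fin.take s (hs.trans hn) ys) < a

theorem alive_take (w : X → Y → Y → Z → ℝ) (ℋ : Finset (X → Y)) (a : ℝ) {t m n m' n' : ℕ}
    (hm : t ≤ m) (hn : t ≤ n) (hm' : m ≤ m') (hn' : n ≤ n') (xs : Fin m' → X)
    (ys : Fin n' → Z) :
    alive w ℋ a t hm hn (Fin.take m hm' xs) (Fin.take n hn' ys) =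
      alive w ℋ a t (hm.trans hm') (hn.trans hn') xs ys :=
  rfl

open Classical in
theorem exists_plurality [Fintype Y] [Nonempty Y] (A : Finset (X → Y)) (x : X) :
    ∃ y, ∀ y', (A.filter fun i => i x = y').card ≤ (A.filter fun i => i x = y).card :=
  Finite.exists_max fun y => (A.filter fun i => i x = y).card

noncomputable def plurality [Fintype Y] [Nonempty Y] (A : Finset (X → Y)) (x : X) : Y :=
  (exists_plurality A x).choose

-- Used with `y` the true label: if the vote misses it, the holders of `y` are no more numerous than
-- those of the plurality label, who all disagree with `y`.
open Classical in
theorem card_le_two_mul_card_of_plurality_ne [Fintype Y] [Nonempty Y] (A : Finset (X → Y))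
    (x : X) {y : Y} (h : y ≠ plurality A x) :
    A.card ≤ 2 * (A.filter fun i => i x ≠ y).card := by
  have h1 : (A.filter fun i => i x = y).card ≤ (A.filter fun i => i x = plurality A x).card :=
    (exists_plurality A x).choose_spec y
  have h2 : (A.filter fun i => i x = plurality A x).card ≤ (A.filter fun i => i x ≠ y).card :=
    Finset.card_le_card (Finset.monotone_filter_right A fun i _ hi => by
      simp only [hi]; exact h.symm)
  have h3 := Finset.card_filter_add_card_filter_not (s := A) fun i => i x = y
  simp only [ne_eq] at h2 ⊢
  omega

open Classical in
/-- The learner predicts the plurality label of the hypotheses that are alive. -/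
noncomputable def pluralityPredictor [Fintype Y] [Nonempty Y] (w : X → Y → Y → Z → ℝ)
    (ℋ : Finset (X → Y)) (a : ℝ) : Predictor X Y Z := fun t xs ys =>
  ⟨Pi.single (plurality (alive w ℋ a t t.le_succ le_rfl xs ys) (xs (Fin.last t))) 1,
    single_mem_stdSimplex ℝ _⟩

theorem eq_plurality_of_predLaw_ne_zero [Fintype Y] [Nonempty Y] {w : X → Y → Y → Z → ℝ}
    {ℋ : Finset (X → Y)} {a : ℝ} {T : ℕ} {xs : Fin T → X} {ys : Fin T → Z} {yhat : Fin T → Y}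
    (h : predLaw (pluralityPredictor w ℋ a) xs ys yhat ≠ 0) (t : Fin T) :
    yhat t = plurality (alive w ℋ a t t.isLt.le t.isLt.le xs ys) (xs t) := by
  classical
  have h1 := Finset.prod_ne_zero_iff.1 h t (Finset.mem_univ t)
  by_contra h2
  refine h1 ?_
  simp only [pluralityPredictor, alive_take]
  exact Pi.single_eq_of_ne h2 _

variable {w : X → Y → Y → Z → ℝ} {γ : ℝ}

theorem pairWeight_pos (hw : ∀ x y y' z, 0 < w x y y' z) (i j : X → Y) {n : ℕ}
    (xs : Fin n → X) (ys : Fin n → Z) : 0 < pairWeight w i j xs ys :=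
  Finset.prod_pos fun _ _ => hw _ _ _ _

open Classical in
theorem pairWeight_mul_swap (hw1 : ∀ x y z, w x y y z = 1)
    (hw2 : ∀ x y y' z, y ≠ y' → w x y y' z * w x y' y z = Real.exp γ) (i j : X → Y) {n : ℕ}
    (xs : Fin n → X) (ys : Fin n → Z) :
    pairWeight w i j xs ys * pairWeight w j i xs ys =
      Real.exp ((Finset.univ.filter fun s => i (xs s) ≠ j (xs s)).card * γ) := by
  unfold pairWeight
  rw [← Finset.prod_mul_distrib, Real.exp_nat_mul, ← Finset.prod_const, Finset.prod_filter]
  refine Finset.prod_congr rfl fun s _ => ?_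
  split_ifs with h
  · exact hw2 _ _ _ _ h
  · rw [not_not.1 h, hw1, one_mul]

open Classical in
/-- Two hypotheses that are alive have disagreed at most `2 log a / γ` times. -/
theorem card_disagree_le (hγ : 0 < γ) (hw : ∀ x y y' z, 0 < w x y y' z)
    (hw1 : ∀ x y z, w x y y z = 1)
    (hw2 : ∀ x y y' z, y ≠ y' → w x y y' z * w x y' y z = Real.exp γ) {ℋ : Finset (X → Y)}
    {a : ℝ} (ha : 0 < a) {i j : X → Y} (hi : i ∈ ℋ) (hj : j ∈ ℋ) {n : ℕ} {xs : Fin n → X}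
    {ys : Fin n → Z} (hia : score w ℋ i xs ys < a) (hja : score w ℋ j xs ys < a) :
    ((Finset.univ.filter fun s => i (xs s) ≠ j (xs s)).card : ℝ) ≤ 2 * Real.log a / γ := by
  have hle : ∀ {i j}, j ∈ ℋ → pairWeight w i j xs ys ≤ score w ℋ i xs ys := fun {i j} hj =>
    Finset.single_le_sum (f := fun j => pairWeight w i j xs ys)
      (fun j _ => (pairWeight_pos hw i j xs ys).le) hj
  have h1 := mul_le_mul ((hle hj).trans hia.le) ((hle hi).trans hja.le)
    (pairWeight_pos hw j i xs ys).le ha.le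
  rw [pairWeight_mul_swap hw1 hw2, ← Real.le_log_iff_exp_le (by positivity),
    Real.log_mul ha.ne' ha.ne'] at h1
  rw [le_div_iff₀ hγ]
  linarith

-- Being alive at `t` constrains only the rounds before `t`. At the last round of `E` both
-- hypotheses are alive, which bounds the earlier disagreements; that last round accounts for the `+
-- 1`.
open Classical in
theorem card_alive_disagree_le (hγ : 0 < γ) (hw : ∀ x y y' z, 0 < w x y y' z)
    (hw1 : ∀ x y z, w x y y z = 1)
    (hw2 : ∀ x y y' z, y ≠ y' → w x y y' z * w x y' y z = Real.exp γ) {ℋ : Finset (X → Y)}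
    {a : ℝ} (ha : 1 ≤ a) {T : ℕ} {xs : Fin T → X} {ys : Fin T → Z} {i h : X → Y}
    {E : Finset (Fin T)}
    (hE : ∀ t ∈ E, i ∈ alive w ℋ a t t.isLt.le t.isLt.le xs ys ∧
      h ∈ alive w ℋ a t t.isLt.le t.isLt.le xs ys ∧ i (xs t) ≠ h (xs t)) :
    (E.card : ℝ) ≤ 2 * Real.log a / γ + 1 := by
  rcases E.eq_empty_or_nonempty with rfl | hne
  · have := Real.log_nonneg ha
    simp only [Finset.card_empty, Nat.cast_zero]
    positivity
  · obtain ⟨τ, hτ, hmax⟩ := E.exists_max_image id hne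
    obtain ⟨hi, hh, -⟩ := hE τ hτ
    simp only [alive, Finset.mem_filter] at hi hh
    have h1 := card_disagree_le hγ hw hw1 hw2 (by linarith) hi.1 hh.1 (hi.2 τ le_rfl)
      (hh.2 τ le_rfl)
    have hsub : E.erase τ ⊆ (Finset.univ.filter fun s : Fin τ =>
        i (Fin.take τ τ.isLt.le xs s) ≠ h (Fin.take τ τ.isLt.le xs s)).map
          (Fin.castLEEmb τ.isLt.le) := by
      intro t ht
      obtain ⟨ht1, ht2⟩ := Finset.mem_erase.1 ht
      have hlt : t < τ := lt_of_le_of_ne (hmax t ht2) ht1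
      exact Finset.mem_map.2 ⟨⟨t, hlt⟩, Finset.mem_filter.2
        ⟨Finset.mem_univ _, (hE t ht2).2.2⟩, rfl⟩
    have h2 := Finset.card_le_card hsub
    rw [Finset.card_map, Finset.card_erase_of_mem hτ] at h2
    have h3 : (E.card : ℝ) ≤ (Finset.univ.filter fun s : Fin τ =>
        i (Fin.take τ τ.isLt.le xs s) ≠ h (Fin.take τ τ.isLt.le xs s)).card + 1 := by
      exact_mod_cast Nat.le_add_of_sub_le h2
    linarith

/-- While the ground truth is alive the plurality vote errs rarely. -/
theorem numErrors_le_of_alive [Fintype Y] [Nonempty Y] (hγ : 0 < γ)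
    (hw : ∀ x y y' z, 0 < w x y y' z) (hw1 : ∀ x y z, w x y y z = 1)
    (hw2 : ∀ x y y' z, y ≠ y' → w x y y' z * w x y' y z = Real.exp γ) {ℋ : Finset (X → Y)}
    {a : ℝ} (ha : 1 ≤ a) {T : ℕ} {xs : Fin T → X} {ys : Fin T → Z} {h : X → Y}
    {yhat : Fin T → Y}
    (hh : h ∈ alive w ℋ a T le_rfl le_rfl xs ys)
    (hyhat : ∀ t : Fin T,
      yhat t = plurality (alive w ℋ a t t.isLt.le t.isLt.le xs ys) (xs t)) :
    numErrors h xs yhat ≤ 2 * ((2 * Real.log a / γ + 1) * Real.log ℋ.card) := by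
  classical
  let A : Fin T → Finset (X → Y) := fun t => alive w ℋ a t t.isLt.le t.isLt.le xs ys
  let D : Fin T → Finset (X → Y) := fun t => (A t).filter fun i => i (xs t) ≠ h (xs t)
  have hhA : ∀ t, h ∈ A t := by
    intro t
    have h1 := Finset.mem_filter.1 hh
    exact Finset.mem_filter.2 ⟨h1.1, fun s hs => h1.2 s (hs.trans t.isLt.le)⟩
  have hlog := Real.log_nonneg ha
  have hsum := sum_card_div_card_le (A := A) (D := D) (H := ℋ) (i₀ := h)
    (N := 2 * Real.log a / γ + 1) (by positivity)
    (fun t t' htt' i hi => by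
      have h1 := Finset.mem_filter.1 hi
      exact Finset.mem_filter.2 ⟨h1.1, fun s hs => h1.2 s (hs.trans htt')⟩)
    (fun t => Finset.filter_subset _ _) (fun t => Finset.filter_subset _ _) hhA
    (fun t ht => (Finset.mem_filter.1 ht).2 rfl)
    (fun i _ E hE => card_alive_disagree_le (xs := xs) (ys := ys) (i := i) (h := h) hγ hw hw1
      hw2 ha fun t ht =>
        ⟨(Finset.mem_filter.1 (hE t ht)).1, hhA t, (Finset.mem_filter.1 (hE t ht)).2⟩)
  refine le_trans ?_ (mul_le_mul_of_nonneg_left hsum zero_le_two)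
  rw [Finset.mul_sum]
  refine Finset.sum_le_sum fun t _ => ?_
  have hApos : (0 : ℝ) < (A t).card := by exact_mod_cast Finset.card_pos.2 ⟨h, hhA t⟩
  split_ifs with h1
  · rw [hyhat t] at h1
    have h2 := card_le_two_mul_card_of_plurality_ne _ _ h1
    rw [← mul_div_assoc, le_div_iff₀ hApos, one_mul]
    exact_mod_cast h2
  · positivity

variable [Fintype Z] {𝒦 : NoiseKernel X Y Z}

open Classical in
/-- The ground truth is eliminated with probability at most `|ℋ| / a`. -/
theorem mul_prob_not_alive_le (hw : ∀ x y y' z, 0 < w x y y' z)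
    (hw3 : ∀ x y y', ∀ p ∈ 𝒦.dists x y, ∑ z, p z * w x y y' z ≤ 1) {ℋ : Finset (X → Y)}
    {h : X → Y} (hh : h ∈ ℋ) (A : Adversary 𝒦 h) (a : ℝ) (T : ℕ) :
    a * ∑ ys : Fin T → Z,
      (if h ∈ alive w ℋ a T le_rfl le_rfl (A.features ys) ys then 0 else A.law ys) ≤
        ℋ.card := by
  have hcond : ∀ t v, A.cond t v ∈ stdSimplex ℝ Z := fun t v =>
    𝒦.dists_subset _ _ (A.cond_mem t v)
  -- Along the adversary's features, `seqLaw (c j)` is the pair weight of `h, j`; the sum over `j`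
  -- is the score of `h`, with initial value `|ℋ|`.
  let c : (X → Y) → (t : ℕ) → (Fin t → Z) → Z → ℝ := fun j t v z =>
    w (A.feature t v) (h (A.feature t v)) (j (A.feature t v)) z
  have hville := ville_inequality (c := A.cond) (fun t v => (hcond t v).2)
    (fun t v => (hcond t v).1) (fun t v => ∑ j ∈ ℋ, seqLaw (c j) v)
    (fun t v => Finset.sum_nonneg fun j _ => seqLaw_nonneg (fun _ _ _ => (hw _ _ _ _).le) v)
    (fun t v => by
      simp only [seqLaw_snoc, Finset.mul_sum]
      rw [Finset.sum_comm]
      refine Finset.sum_le_sum fun j _ => ?_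
      have h1 := mul_le_mul_of_nonneg_left
        (hw3 (A.feature t v) (h (A.feature t v)) (j (A.feature t v)) _ (A.cond_mem t v))
        (seqLaw_nonneg (c := c j) (fun _ _ _ => (hw _ _ _ _).le) v)
      rw [mul_one, Finset.mul_sum] at h1
      refine le_trans (le_of_eq ?_) h1
      exact Finset.sum_congr rfl fun z _ => by ring)
    a T
  refine le_trans (le_of_eq ?_) (hville.trans (le_of_eq ?_))
  · congr 1
    refine Finset.sum_congr rfl fun ys _ => ?_
    rw [← ite_not]
    refine if_congr ?_ rfl rfl
    simp only [alive, Finset.mem_filter, hh, true_and, not_forall, not_lt]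
    rfl
  · simp [seqLaw]

theorem highProbRisk_le [Nonempty X] [Fintype Y] [Nontrivial Y] {γ δ : ℝ}
    (hconv : ∀ x y, Convex ℝ (𝒦.dists x y)) (hcl : ∀ x y, IsClosed (𝒦.dists x y))
    (hsep : WellSeparated hellingerSq 𝒦 γ) {ℋ : Finset (X → Y)} (hK : 1 ≤ ℋ.card) (T : ℕ)
    (hδ : 0 < δ) (hδ1 : δ ≤ 1) :
    highProbRisk ℋ 𝒦 T δ ≤
      8 * Real.log (4 * ℋ.card / δ) * Real.log ℋ.card / γ + Real.log (2 / δ) := by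
  classical
  have hγ := hsep.1
  have hγ2 := hsep.le_two
  obtain ⟨w, hw, hw1, hw2, hw3⟩ := hsep.exists_weights hconv hcl
  have hK' : (1 : ℝ) ≤ ℋ.card := by exact_mod_cast hK
  let a : ℝ := ℋ.card / δ
  have ha : 1 ≤ a := by
    rw [le_div_iff₀ hδ]
    linarith
  have hloga := Real.log_nonneg ha
  have hlogK := Real.log_nonneg hK'
  have hlog4 : 1 ≤ Real.log 4 := by
    have := Real.log_two_gt_d9
    rw [show (4 : ℝ) = 2 ^ 2 by norm_num, Real.log_pow]
    push_cast
    linarith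
  have hlogδ : 0 < Real.log (2 / δ) := Real.log_pos (by rw [lt_div_iff₀ hδ]; linarith)
  have hlog4a : Real.log (4 * ℋ.card / δ) = Real.log 4 + Real.log a := by
    rw [mul_div_assoc, Real.log_mul (by norm_num) (by positivity)]
  -- The `+ 1` contributes `2 γ ≤ 4`, which is absorbed by `8 log 4`.
  have hbound : 2 * ((2 * Real.log a / γ + 1) * Real.log ℋ.card) ≤
      8 * Real.log (4 * ℋ.card / δ) * Real.log ℋ.card / γ := by
    rw [hlog4a, le_div_iff₀ hγ]
    have h1 : 2 * ((2 * Real.log a / γ + 1) * Real.log ℋ.card) * γ =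
        (4 * Real.log a + 2 * γ) * Real.log ℋ.card := by
      field_simp
      ring
    rw [h1]
    exact mul_le_mul_of_nonneg_right (by linarith) hlogK
  refine csInf_le ⟨0, fun b hb => hb.1⟩ ⟨?_, pluralityPredictor w ℋ a, fun h hh A => ?_⟩
  · have : 0 ≤ 8 * Real.log (4 * ℋ.card / δ) * Real.log ℋ.card / γ := by
      rw [hlog4a]
      positivity
    linarith
  · have hprob := mul_prob_not_alive_le hw hw3 hh A a T
    rw [← le_div_iff₀' (by linarith), div_div_cancel₀ (by linarith)] at hprob
    refine le_trans (Finset.sum_le_sum fun ys _ => ?_) hprob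
    have hlaw : 0 ≤ A.law ys :=
      Finset.prod_nonneg fun t _ => (𝒦.dists_subset _ _ (A.cond_mem t _)).1 _
    calc _ ≤ ∑ yhat : Fin T → Y,
          (if h ∈ alive w ℋ a T le_rfl le_rfl (A.features ys) ys then 0 else A.law ys) *
            predLaw (pluralityPredictor w ℋ a) (A.features ys) ys yhat := by
          refine Finset.sum_le_sum fun yhat _ => ?_
          have hpred := predLaw_nonneg (pluralityPredictor w ℋ a) (A.features ys) ys yhat
          by_cases h1 : h ∈ alive w ℋ a T le_rfl le_rfl (A.features ys) ys
          · rw [if_pos h1, zero_mul]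
            split_ifs with h2
            · by_cases h3 : predLaw (pluralityPredictor w ℋ a) (A.features ys) ys yhat = 0
              · rw [h3, mul_zero]
              -- The errors stay strictly below the threshold because `log (2 / δ) > 0`, so this
              -- case is contradictory.
              · have h4 := numErrors_le_of_alive hγ hw hw1 hw2 ha h1
                  (eq_plurality_of_predLaw_ne_zero h3)
                linarith
            · exact le_rfl
          · rw [if_neg h1]
            split_ifs
            · exact le_rfl
            · exact mul_nonneg hlaw hpred
      _ = _ := by rw [← Finset.mul_sum, sum_predLaw, mul_one]

end Upper

/-! ### Le Cam's method on a hypercube and the lower bound. -/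

section Lower

variable {X Y Z : Type*}

open Classical in
/-- The vertices of the hypercube spanned by the labels `a`, `b` on the features `e`. -/
noncomputable def cubeHyp {d : ℕ} (e : Fin d → X) (a b : X → Y) (v : Fin d → Bool) : X → Y :=
  fun x => if ∃ k, e k = x ∧ v k = true then a x else b x

theorem cubeHyp_apply {d : ℕ} {e : Fin d → X} (he : Function.Injective e) (a b : X → Y)
    (v : Fin d → Bool) (k : Fin d) :
    cubeHyp e a b v (e k) = if v k = true then a (e k) else b (e k) := by
  classical
  unfold cubeHyp
  refine if_congr ⟨?_, fun h => ⟨k, rfl, h⟩⟩ rfl rfl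
  rintro ⟨k', h1, h2⟩
  rwa [← he h1]

theorem sum_mul_mem_Icc [Fintype Z] {p f : Z → ℝ} (hp : p ∈ stdSimplex ℝ Z) {B : ℝ}
    (hf : ∀ z, f z ∈ Set.Icc 0 B) : ∑ z, p z * f z ∈ Set.Icc 0 B := by
  refine ⟨Finset.sum_nonneg fun z _ => mul_nonneg (hp.1 z) (hf z).1, ?_⟩
  refine (Finset.sum_le_sum fun z _ =>
    mul_le_mul_of_nonneg_left (hf z).2 (hp.1 z)).trans_eq ?_
  rw [← Finset.sum_mul, hp.2, one_mul]

theorem sum_predLaw_mul_numErrors [Fintype Y] {T : ℕ} (Φ : Predictor X Y Z) (h : X → Y)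
    (xs : Fin T → X) (ys : Fin T → Z) :
    ∑ yhat : Fin T → Y, predLaw Φ xs ys yhat * numErrors h xs yhat =
      ∑ t : Fin T, (1 -
        (Φ t (Fin.take (t + 1) t.isLt xs) (Fin.take t t.isLt.le ys) : Y → ℝ) (h (xs t))) := by
  classical
  simp only [numErrors, Finset.mul_sum]
  rw [Finset.sum_comm]
  refine Finset.sum_congr rfl fun t _ => ?_
  have h1 := sum_predLaw_mul_apply Φ xs ys t fun y => if h (xs t) ≠ y then 1 else 0
  have h2 := (Φ t (Fin.take (t + 1) t.isLt xs) (Fin.take t t.isLt.le ys)).2.2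
  refine (Eq.trans ?_ (h1.trans ?_))
  · refine Finset.sum_congr rfl fun yhat _ => ?_
    congr
  · refine Eq.trans ?_ (congrArg (fun r => r - (Φ t (Fin.take (t + 1) t.isLt xs)
      (Fin.take t t.isLt.le ys) : Y → ℝ) (h (xs t))) h2)
    rw [← Finset.sum_erase_add _ _ (Finset.mem_univ (h (xs t))),
      ← Finset.sum_erase_add _ (fun y => (Φ t _ _).1 y) (Finset.mem_univ (h (xs t)))]
    simp only [ne_eq, not_true_eq_false, if_false, mul_zero, add_zero]
    refine Eq.trans (Finset.sum_congr rfl fun y hy => ?_) (add_sub_cancel_right _ _).symm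
    rw [if_pos (Finset.ne_of_mem_erase hy).symm, mul_one]
    rfl

theorem expectedLoss_mem_Icc [Fintype Y] {T : ℕ} (Φ : Predictor X Y Z) (h : X → Y)
    (xs : Fin T → X) (ys : Fin T → Z) :
    ∑ yhat : Fin T → Y, predLaw Φ xs ys yhat * numErrors h xs yhat ∈ Set.Icc (0 : ℝ) T := by
  refine sum_mul_mem_Icc ⟨predLaw_nonneg Φ xs ys, sum_predLaw Φ xs ys⟩ fun yhat => ?_
  constructor
  · exact Finset.sum_nonneg fun t _ => by split_ifs <;> norm_num
  · refine (Finset.sum_le_sum (g := fun _ => (1 : ℝ)) fun t _ => ?_).trans_eq (by simp)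
    split_ifs <;> norm_num

variable [Fintype Z]

theorem ciSup_mem_Icc {ι : Type*} [Nonempty ι] {f : ι → ℝ} {B : ℝ}
    (hf : ∀ i, f i ∈ Set.Icc 0 B) : ⨆ i, f i ∈ Set.Icc 0 B :=
  ⟨Real.iSup_nonneg fun i => (hf i).1, ciSup_le fun i => (hf i).2⟩

theorem bddAbove_range_of_mem_Icc {ι : Type*} {f : ι → ℝ} {B : ℝ}
    (hf : ∀ i, f i ∈ Set.Icc 0 B) : BddAbove (Set.range f) :=
  ⟨B, by rintro _ ⟨i, rfl⟩; exact (hf i).2⟩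

instance (𝒦 : NoiseKernel X Y Z) (x : X) (y : Y) : Nonempty (𝒦.dists x y) :=
  (𝒦.dists_nonempty x y).to_subtype

theorem advOp_mem_Icc [Nonempty X] (𝒦 : NoiseKernel X Y Z) (h : X → Y) {B : ℝ} (T : ℕ)
    (F : (Fin T → X) → (Fin T → Z) → ℝ) (hF : ∀ xs ys, F xs ys ∈ Set.Icc 0 B) :
    advOp 𝒦 h T F ∈ Set.Icc 0 B := by
  induction T with
  | zero => exact hF _ _
  | succ T ih =>
    exact ciSup_mem_Icc fun x => ciSup_mem_Icc fun p =>
      sum_mul_mem_Icc (𝒦.dists_subset _ _ p.2) fun z => ih _ fun xs ys => hF _ _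

/-- A non-adaptive strategy bounds the operator `advOp` from below. -/
theorem sum_prod_mul_le_advOp [Nonempty X] (𝒦 : NoiseKernel X Y Z) (h : X → Y) {B : ℝ} (T : ℕ)
    (F : (Fin T → X) → (Fin T → Z) → ℝ) (hF : ∀ xs ys, F xs ys ∈ Set.Icc 0 B)
    (xs : Fin T → X) (c : Fin T → Z → ℝ) (hc : ∀ t, c t ∈ 𝒦.dists (xs t) (h (xs t))) :
    ∑ ys : Fin T → Z, (∏ t, c t (ys t)) * F xs ys ≤ advOp 𝒦 h T F := by
  induction T with
  | zero =>
    rw [Fintype.sum_unique, Fin.prod_univ_zero, one_mul]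
    exact le_of_eq (congrArg₂ F (Subsingleton.elim _ _) (Subsingleton.elim _ _))
  | succ T ih =>
    have hmem : ∀ x z, advOp 𝒦 h T (fun xs ys => F (Fin.cons x xs) (Fin.cons z ys)) ∈
        Set.Icc 0 B := fun x z => advOp_mem_Icc 𝒦 h T _ fun xs ys => hF _ _
    have hmem' : ∀ (x : X) (p : 𝒦.dists x (h x)), ∑ z, (p : Z → ℝ) z *
        advOp 𝒦 h T (fun xs ys => F (Fin.cons x xs) (Fin.cons z ys)) ∈ Set.Icc 0 B :=
      fun x p => sum_mul_mem_Icc (𝒦.dists_subset _ _ p.2) (hmem x)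
    have h1 := le_ciSup (bddAbove_range_of_mem_Icc (hmem' (xs 0))) ⟨c 0, hc 0⟩
    have h2 := le_ciSup (bddAbove_range_of_mem_Icc fun x => ciSup_mem_Icc (hmem' x)) (xs 0)
    refine le_trans (le_trans ?_ h1) h2
    rw [← (Fin.consEquiv fun _ : Fin (T + 1) => Z).sum_comp, Fintype.sum_prod_type]
    refine Finset.sum_le_sum fun z _ => ?_
    have h3 := mul_le_mul_of_nonneg_left (ih
      (fun xs' ys => F (Fin.cons (xs 0) xs') (Fin.cons z ys)) (fun _ _ => hF _ _)
      (Fin.tail xs) (Fin.tail c) fun t => hc t.succ)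
      ((𝒦.dists_subset _ _ (hc 0)).1 z)
    refine le_trans (le_of_eq ?_) h3
    rw [Finset.mul_sum]
    refine Finset.sum_congr rfl fun ys _ => ?_
    simp only [Fin.consEquiv, Equiv.coe_fn_mk, Fin.prod_univ_succ, Fin.cons_zero,
      Fin.cons_succ, Fin.cons_self_tail, mul_assoc]
    rfl

/-- Le Cam's inequality between the testing affinity and the Hellinger affinity. -/
theorem sq_sum_sqrt_mul_le {W : Type*} [Fintype W] {p q : W → ℝ} (hp : ∀ i, 0 ≤ p i)
    (hq : ∀ i, 0 ≤ q i) (hp1 : ∑ i, p i = 1) (hq1 : ∑ i, q i = 1) :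
    (∑ i, Real.sqrt (p i * q i)) ^ 2 ≤ 2 * ∑ i, min (p i) (q i) := by
  -- Cauchy–Schwarz is applied to `p q = min · max`; the maxima sum to at most 2.
  have h1 : ∀ i, Real.sqrt (p i * q i) =
      Real.sqrt (min (p i) (q i)) * Real.sqrt (max (p i) (q i)) := by
    intro i
    rw [← Real.sqrt_mul (le_min (hp i) (hq i)), min_mul_max]
  simp only [h1]
  refine (Finset.sum_mul_sq_le_sq_mul_sq _ _ _).trans ?_
  have h2 : ∑ i, Real.sqrt (min (p i) (q i)) ^ 2 = ∑ i, min (p i) (q i) :=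
    Finset.sum_congr rfl fun i _ => Real.sq_sqrt (le_min (hp i) (hq i))
  have h3 : ∑ i, Real.sqrt (max (p i) (q i)) ^ 2 = ∑ i, max (p i) (q i) :=
    Finset.sum_congr rfl fun i _ => Real.sq_sqrt (le_max_of_le_left (hp i))
  have h4 : ∑ i, max (p i) (q i) ≤ 2 := by
    refine (Finset.sum_le_sum fun i _ =>
      max_le_add_of_nonneg (hp i) (hq i)).trans_eq ?_
    rw [Finset.sum_add_distrib, hp1, hq1]
    norm_num
  rw [h2, h3, mul_comm]
  exact mul_le_mul_of_nonneg_right h4 (Finset.sum_nonneg fun i _ => le_min (hp i) (hq i))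

theorem sum_sqrt_seqLaw_mul {c c' : ℕ → Z → ℝ} (hc : ∀ t z, 0 ≤ c t z)
    (hc' : ∀ t z, 0 ≤ c' t z) (n : ℕ) :
    ∑ w : Fin n → Z, Real.sqrt (seqLaw (fun t _ => c t) w * seqLaw (fun t _ => c' t) w) =
      ∏ s : Fin n, ∑ z, Real.sqrt (c s z * c' s z) := by
  classical
  rw [Fintype.prod_sum]
  refine Finset.sum_congr rfl fun w _ => ?_
  unfold seqLaw
  rw [← Finset.prod_mul_distrib, Real.sqrt_prod]
  exact fun s _ => mul_nonneg (hc _ _) (hc' _ _)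

/-- Bernoulli's inequality: `(1 - γ) ^ (2 m) ≥ 1 - 2 m γ`. -/
theorem three_fourths_le_sq_pow {γ ρ : ℝ} {m : ℕ} (hγ : 0 < γ) (hργ : 1 - γ ≤ ρ)
    (hm : m * (8 * γ) ≤ 1) : 3 / 4 ≤ (ρ ^ m) ^ 2 := by
  rcases Nat.eq_zero_or_pos m with rfl | hm0
  · norm_num
  · have hm1 : (1 : ℝ) ≤ m := by exact_mod_cast hm0
    have hγ1 : 8 * γ ≤ 1 := (le_mul_of_one_le_left (by linarith) hm1).trans hm
    have h1 := one_add_mul_le_pow (a := -γ) (by linarith) (m * 2)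
    push_cast at h1
    have h2 : (1 + -γ) ^ (m * 2) ≤ ρ ^ (m * 2) :=
      pow_le_pow_left₀ (by linarith) (by linarith) _
    rw [← pow_mul]
    linarith

/-- Two product laws that agree outside of a block of `n` rounds cannot be told apart within the
block if the affinity of the laws of a single round is at least `1 - γ` and `8 (n - 1) γ ≤ 1`. -/
theorem three_eighths_le_sum_min {c c' : ℕ → Z → ℝ} (hc : ∀ t, c t ∈ stdSimplex ℝ Z)
    (hc' : ∀ t, c' t ∈ stdSimplex ℝ Z) {γ ρ : ℝ} {m n t : ℕ} (hγ : 0 < γ)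
    (hργ : 1 - γ ≤ ρ) (hn : ((n - 1 : ℕ) : ℝ) * (8 * γ) ≤ 1) (ht : t < m + n)
    (hagree : ∀ s < m, c s = c' s)
    (hblock : ∀ s, m ≤ s → s < t → ∑ z, Real.sqrt (c s z * c' s z) = ρ) :
    3 / 8 ≤ ∑ w : Fin t → Z,
      min (seqLaw (fun t _ => c t) w) (seqLaw (fun t _ => c' t) w) := by
  have h0 := sq_sum_sqrt_mul_le (p := fun w : Fin t → Z => seqLaw (fun t _ => c t) w)
    (q := fun w => seqLaw (fun t _ => c' t) w)
    (fun w => seqLaw_nonneg (fun t _ => (hc t).1) w)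
    (fun w => seqLaw_nonneg (fun t _ => (hc' t).1) w)
    (sum_seqLaw (fun t _ => (hc t).2) t) (sum_seqLaw (fun t _ => (hc' t).2) t)
  rw [sum_sqrt_seqLaw_mul (fun t => (hc t).1) (fun t => (hc' t).1),
    Fin.prod_univ_eq_prod_range (fun s => ∑ z, Real.sqrt (c s z * c' s z)) t] at h0
  have hone : ∀ s < m, ∑ z, Real.sqrt (c s z * c' s z) = 1 := by
    intro s hs
    rw [← (hc' s).2]
    refine Finset.sum_congr rfl fun z _ => ?_
    rw [hagree s hs, Real.sqrt_mul_self ((hc' s).1 z)]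
  rcases le_or_gt t m with htm | htm
  · rw [Finset.prod_eq_one fun s hs =>
      hone s ((Finset.mem_range.1 hs).trans_le htm)] at h0
    linarith
  · have hprod : ∏ s ∈ Finset.range t, ∑ z, Real.sqrt (c s z * c' s z) = ρ ^ (t - m) := by
      rw [← Finset.prod_range_mul_prod_Ico _ htm.le,
        Finset.prod_eq_one fun s hs => hone s (Finset.mem_range.1 hs), one_mul,
        Finset.prod_congr rfl fun s hs =>
          hblock s (Finset.mem_Ico.1 hs).1 (Finset.mem_Ico.1 hs).2]
      simp
    -- Before a round of the block, at most `n - 1` labels of that block have been revealed.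
    have hle : ((t - m : ℕ) : ℝ) ≤ ((n - 1 : ℕ) : ℝ) := by
      exact_mod_cast (by omega : t - m ≤ n - 1)
    have h1 := three_fourths_le_sq_pow hγ hργ
      ((mul_le_mul_of_nonneg_right hle (by linarith)).trans hn)
    rw [hprod] at h0
    linarith

theorem exists_le_expectedRisk [Nonempty X] [Fintype Y] [Nonempty Y] (𝒦 : NoiseKernel X Y Z)
    {ℋ : Finset (X → Y)} {T : ℕ} {r : ℝ}
    (hr : ∀ Φ : Predictor X Y Z, ∃ h ∈ ℋ, r ≤ advOp 𝒦 h T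
      (fun xs ys => ∑ yhat : Fin T → Y, predLaw Φ xs ys yhat * numErrors h xs yhat)) :
    r ≤ expectedRisk ℋ 𝒦 T := by
  classical
  have : Nonempty (Predictor X Y Z) :=
    ⟨fun _ _ _ => ⟨Pi.single (Classical.arbitrary Y) 1, single_mem_stdSimplex ℝ _⟩⟩
  refine le_ciInf fun Φ => ?_
  obtain ⟨h, hh, hle⟩ := hr Φ
  exact hle.trans (le_ciSup (f := fun h : ℋ => advOp 𝒦 (h : X → Y) T fun xs ys =>
    ∑ yhat : Fin T → Y, predLaw Φ xs ys yhat * numErrors (h : X → Y) xs yhat)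
    (Finite.bddAbove_range _) ⟨h, hh⟩)

/-- A class that shatters `d` features, at each of which the two laws have affinity at least
`1 - γ`, has risk of order `min T (d n)` when each feature may be repeated `n` times. -/
theorem min_le_expectedRisk [Nonempty X] [Fintype Y] [Nonempty Y] (𝒦 : NoiseKernel X Y Z)
    {ℋ : Finset (X → Y)} {d n : ℕ} {γ : ℝ} (hγ : 0 < γ) (hn0 : 0 < n)
    (hn : ((n - 1 : ℕ) : ℝ) * (8 * γ) ≤ 1) {e : Fin d → X} (he : Function.Injective e)
    {a b : X → Y} (hab : ∀ k, a (e k) ≠ b (e k)) {p q : Fin d → Z → ℝ}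
    (hp : ∀ k, p k ∈ 𝒦.dists (e k) (a (e k))) (hq : ∀ k, q k ∈ 𝒦.dists (e k) (b (e k)))
    (hpq : ∀ k, 1 - γ ≤ ∑ z, Real.sqrt (p k z * q k z))
    (hℋ : ∀ v, cubeHyp e a b v ∈ ℋ) (T : ℕ) :
    3 / 16 * ((min T (d * n) : ℕ) : ℝ) ≤ expectedRisk ℋ 𝒦 T := by
  classical
  -- Round `t` shows feature number `t / n`; rounds from `d * n` on are irrelevant and get an
  -- arbitrary feature.
  let feat : ℕ → X := fun t => if hk : t / n < d then e ⟨t / n, hk⟩ else Classical.arbitrary X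
  have hfeat : ∀ t (hk : t / n < d), feat t = e ⟨t / n, hk⟩ := fun t hk => dif_pos hk
  have hex : ∀ v t, ∃ r ∈ 𝒦.dists (feat t) (cubeHyp e a b v (feat t)),
      ∀ hk : t / n < d, r = if v ⟨t / n, hk⟩ = true then p ⟨t / n, hk⟩ else q ⟨t / n, hk⟩ := by
    intro v t
    by_cases hk : t / n < d
    · refine ⟨if v ⟨t / n, hk⟩ = true then p ⟨t / n, hk⟩ else q ⟨t / n, hk⟩, ?_,
        fun _ => rfl⟩
      rw [hfeat t hk, cubeHyp_apply he]
      split_ifs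
      · exact hp _
      · exact hq _
    · obtain ⟨r, hr⟩ := 𝒦.dists_nonempty (feat t) (cubeHyp e a b v (feat t))
      exact ⟨r, hr, fun h => absurd h hk⟩
  choose c hc hc' using hex
  have hcs : ∀ v t, c v t ∈ stdSimplex ℝ Z := fun v t => 𝒦.dists_subset _ _ (hc v t)
  refine exists_le_expectedRisk 𝒦 fun Φ => ?_
  let err : (Fin d → Bool) → (t : ℕ) → (Fin t → Z) → ℝ := fun v t w =>
    1 - (Φ t (fun s => feat s) w : Y → ℝ) (cubeHyp e a b v (feat t))
  let G : (Fin d → Bool) → ℕ → ℝ := fun v t =>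
    ∑ w : Fin t → Z, seqLaw (fun t _ => c v t) w * err v t w
  have herr : ∀ v t w, 0 ≤ err v t w := fun v t w => by
    have h1 := (Φ t (fun s => feat s) w).2
    have h2 := Finset.single_le_sum (fun y _ => h1.1 y)
      (Finset.mem_univ (cubeHyp e a b v (feat t)))
    rw [h1.2] at h2
    exact sub_nonneg.2 h2
  have hG0 : ∀ v t, 0 ≤ G v t := fun v t => Finset.sum_nonneg fun w _ =>
    mul_nonneg (seqLaw_nonneg (fun t _ => (hcs v t).1) w) (herr v t w)
  have hadv : ∀ v, ∑ t ∈ Finset.range T, G v t ≤ advOp 𝒦 (cubeHyp e a b v) T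
      (fun xs ys => ∑ yhat : Fin T → Y,
        predLaw Φ xs ys yhat * numErrors (cubeHyp e a b v) xs yhat) := by
    intro v
    refine le_trans (le_of_eq ?_) (sum_prod_mul_le_advOp 𝒦 (cubeHyp e a b v) T _
      (expectedLoss_mem_Icc Φ (cubeHyp e a b v)) (fun t => feat t) (fun t => c v t)
      fun t => hc v t)
    simp only [sum_predLaw_mul_numErrors, Finset.mul_sum]
    rw [Finset.sum_comm, ← Fin.sum_univ_eq_sum_range]
    refine Finset.sum_congr rfl fun t _ => ?_
    exact (sum_seqLaw_take (c := fun t _ => c v t) (fun t _ => (hcs v t).2) t.isLt.le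
      (err v t)).symm
  -- The permutation flips the coordinate of the current block. The two vertices induce the same
  -- laws in earlier blocks but require different predictions now.
  have hpair : ∀ t < d * n, ∃ σ : Equiv.Perm (Fin d → Bool), ∀ v, 3 / 8 ≤ G v t + G (σ v) t := by
    intro t ht
    have hk : t / n < d := Nat.div_lt_of_lt_mul (by rwa [mul_comm])
    let k : Fin d := ⟨t / n, hk⟩
    let flip : (Fin d → Bool) → Fin d → Bool := fun v => Function.update v k (!v k)
    have hflip : Function.Involutive flip := fun v => by
      simp [flip]
    refine ⟨hflip.toPerm, fun v => ?_⟩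
    change 3 / 8 ≤ G v t + G (flip v) t
    have hsum : ∀ w, 1 ≤ err v t w + err (flip v) t w := by
      intro w
      have hne : cubeHyp e a b v (feat t) ≠ cubeHyp e a b (flip v) (feat t) := by
        rw [hfeat t hk, cubeHyp_apply he, cubeHyp_apply he]
        have : flip v k = !v k := Function.update_self _ _ _
        change (if v k = true then a (e k) else b (e k)) ≠
          if flip v k = true then a (e k) else b (e k)
        rw [this]
        cases v k
        · simpa using (hab k).symm
        · simpa using hab k
      have h1 := (Φ t (fun s => feat s) w).2
      have h2 := Finset.sum_le_sum_of_subset_of_nonneg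
        (Finset.subset_univ {cubeHyp e a b v (feat t), cubeHyp e a b (flip v) (feat t)})
        (fun y _ _ => h1.1 y)
      rw [Finset.sum_pair hne, h1.2] at h2
      change 1 ≤ 1 - (Φ t (fun s => feat s) w).1 (cubeHyp e a b v (feat t)) +
        (1 - (Φ t (fun s => feat s) w).1 (cubeHyp e a b (flip v) (feat t)))
      linarith
    have hmin := three_eighths_le_sum_min (hcs v) (hcs (flip v)) (m := k * n) (t := t)
      hγ (hpq k) hn (by
        have h1 := Nat.div_add_mod t n
        have h2 := Nat.mod_lt t hn0
        have h3 : (k : ℕ) * n = n * (t / n) := mul_comm _ _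
        omega)
      (fun s hs => by
        have hsk : s / n < k := Nat.div_lt_of_lt_mul (by rwa [mul_comm])
        have hsd : s / n < d := hsk.trans k.isLt
        rw [hc' v s hsd, hc' (flip v) s hsd]
        have : flip v ⟨s / n, hsd⟩ = v ⟨s / n, hsd⟩ :=
          Function.update_of_ne (fun h => hsk.ne (congrArg Fin.val h)) _ _
        rw [this])
      (fun s hs hst => by
        have hsk : s / n = t / n := le_antisymm (Nat.div_le_div_right hst.le)
          ((Nat.le_div_iff_mul_le hn0).2 hs)
        have hsd : s / n < d := hsk.trans_lt hk
        have hks : (⟨s / n, hsd⟩ : Fin d) = k := Fin.ext hsk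
        rw [hc' v s hsd, hc' (flip v) s hsd, hks]
        have : flip v k = !v k := Function.update_self _ _ _
        rw [this]
        cases v k
        · simp [mul_comm]
        · simp)
    refine hmin.trans ?_
    simp only [G]
    rw [← Finset.sum_add_distrib]
    refine Finset.sum_le_sum fun w _ => ?_
    have h1 : 0 ≤ min (seqLaw (fun t _ => c v t) w) (seqLaw (fun t _ => c (flip v) t) w) :=
      le_min (seqLaw_nonneg (fun t _ => (hcs v t).1) w)
        (seqLaw_nonneg (fun t _ => (hcs (flip v) t).1) w)
    have h2 := le_mul_of_one_le_right h1 (hsum w)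
    have h3 := mul_le_mul_of_nonneg_right
      (min_le_left (seqLaw (fun t _ => c v t) w) (seqLaw (fun t _ => c (flip v) t) w))
      (herr v t w)
    have h4 := mul_le_mul_of_nonneg_right
      (min_le_right (seqLaw (fun t _ => c v t) w) (seqLaw (fun t _ => c (flip v) t) w))
      (herr (flip v) t w)
    linarith
  -- Summing over all vertices counts each `G v t` twice, so the dependence of `σ` on `t` disappears
  -- and a single vertex can serve all rounds.
  have havg : ∀ t < d * n, ∑ _v : Fin d → Bool, (3 / 16 : ℝ) ≤ ∑ v, G v t := by
    intro t ht
    obtain ⟨σ, hσ⟩ := hpair t ht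
    have h1 := Finset.sum_le_sum fun v (_ : v ∈ Finset.univ) => hσ v
    rw [Finset.sum_add_distrib, Equiv.sum_comp σ fun v => G v t] at h1
    simp only [Finset.sum_const, nsmul_eq_mul] at h1 ⊢
    linarith
  obtain ⟨v, -, hv⟩ := Finset.exists_le_of_sum_le
    (s := (Finset.univ : Finset (Fin d → Bool)))
    (f := fun _ => 3 / 16 * ((min T (d * n) : ℕ) : ℝ))
    (g := fun v => ∑ t ∈ Finset.range T, G v t) Finset.univ_nonempty (by
      calc ∑ _v : Fin d → Bool, 3 / 16 * ((min T (d * n) : ℕ) : ℝ)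
          = ∑ t ∈ Finset.range (min T (d * n)), ∑ _v : Fin d → Bool, (3 / 16 : ℝ) := by
            simp only [Finset.sum_const, Finset.card_range, nsmul_eq_mul]
            ring
        _ ≤ ∑ t ∈ Finset.range (min T (d * n)), ∑ v, G v t :=
            Finset.sum_le_sum fun t ht =>
              havg t ((Finset.mem_range.1 ht).trans_le (min_le_right _ _))
        _ ≤ ∑ t ∈ Finset.range T, ∑ v, G v t :=
            Finset.sum_le_sum_of_subset_of_nonneg
              (Finset.range_mono (min_le_left _ _))
              fun t _ _ => Finset.sum_nonneg fun v _ => hG0 v t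
        _ = ∑ v, ∑ t ∈ Finset.range T, G v t := Finset.sum_comm)
  exact ⟨_, hℋ v, hv.trans (hadv v)⟩

/-- The infimum need not be attained, so a pair with divergence below `2 γ` is taken; its affinity
`1 - H² / 2` exceeds `1 - γ`. -/
theorem exists_sum_sqrt_ge (𝒦 : NoiseKernel X Y Z) {x : X} {y y' : Y} {γ : ℝ} (hγ : 0 < γ)
    (h : setDiv hellingerSq (𝒦.dists x y) (𝒦.dists x y') ≤ γ) :
    ∃ p ∈ 𝒦.dists x y, ∃ q ∈ 𝒦.dists x y', 1 - γ ≤ ∑ z, Real.sqrt (p z * q z) := by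
  obtain ⟨_, ⟨p, hp, q, hq, rfl⟩, hlt⟩ := exists_lt_of_csInf_lt
    ((𝒦.dists_nonempty x y).image2 (𝒦.dists_nonempty x y'))
    (h.trans_lt (by linarith : γ < 2 * γ))
  refine ⟨p, hp, q, hq, ?_⟩
  have hp' := 𝒦.dists_subset _ _ hp
  rw [hellingerSq_eq hp' (𝒦.dists_subset _ _ hq)] at hlt
  have h1 : ∑ z, Real.sqrt (p z * q z) = ∑ z, Real.sqrt (p z) * Real.sqrt (q z) :=
    Finset.sum_congr rfl fun z _ => Real.sqrt_mul (hp'.1 z) _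
  linarith

theorem log_le_two_mul_natLog {K : ℕ} (hK : 1 ≤ K) : Real.log K ≤ 2 * (Nat.log 2 K : ℕ) := by
  have h1 : (K : ℝ) ≤ 2 ^ (Nat.log 2 K + 1) := by
    exact_mod_cast (Nat.lt_pow_succ_log_self one_lt_two K).le
  have h2 := Real.log_le_log (by exact_mod_cast hK) h1
  rw [Real.log_pow] at h2
  push_cast at h2
  have h3 := Real.log_two_lt_d9
  rcases Nat.eq_zero_or_pos (Nat.log 2 K) with h0 | h0
  · have h4 := Nat.lt_pow_succ_log_self one_lt_two K
    rw [h0] at h4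
    obtain rfl : K = 1 := by omega
    simp
  · have h5 : (1 : ℝ) ≤ (Nat.log 2 K : ℕ) := by exact_mod_cast h0
    have h6 := mul_le_mul_of_nonneg_left h3.le
      (by linarith : (0 : ℝ) ≤ (Nat.log 2 K : ℕ) + 1)
    linarith

theorem exists_class_le_expectedRisk [Nonempty X] [Fintype Y] [Nonempty Y]
    (𝒦 : NoiseKernel X Y Z) {K : ℕ} {γ : ℝ} (hK : 1 ≤ K)
    (h𝒢 : ∃ 𝒢 : Finset (X → Y), 𝒢.card = K) (hγ : 0 < γ)
    (hS : ∃ S : Finset X, Real.log K ≤ S.card ∧ ∀ x ∈ S, ∃ y y' : Y, y ≠ y' ∧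
      setDiv hellingerSq (𝒦.dists x y) (𝒦.dists x y') ≤ γ) :
    ∃ ℋ : Finset (X → Y), ℋ.card = K ∧ ∀ T : ℕ, Real.log K / γ ≤ T →
      3 / 256 * (Real.log K / γ) ≤ expectedRisk ℋ 𝒦 T := by
  classical
  obtain ⟨𝒢, h𝒢⟩ := h𝒢
  obtain ⟨S, hSK, hS⟩ := hS
  have hS' : ∀ x, ∃ y y' : Y, x ∈ S → y ≠ y' ∧
      setDiv hellingerSq (𝒦.dists x y) (𝒦.dists x y') ≤ γ := by
    intro x
    by_cases hx : x ∈ S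
    · obtain ⟨y, y', h⟩ := hS x hx
      exact ⟨y, y', fun _ => h⟩
    · exact ⟨Classical.arbitrary Y, Classical.arbitrary Y, fun h => absurd h hx⟩
  choose a b hab using hS'
  have hlogK : 0 ≤ Real.log K := Real.log_natCast_nonneg K
  -- The cube must have at most `K` vertices and use only features of `S`; either bound still leaves
  -- `d ≥ log K / 2`.
  let d := min (Nat.log 2 K) S.card
  have hd2 : 2 ^ d ≤ K :=
    (Nat.pow_le_pow_right two_pos (min_le_left _ _)).trans (Nat.pow_log_le_self 2 (by omega))
  have hdK : Real.log K ≤ 2 * d := by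
    rcases min_choice (Nat.log 2 K) S.card with h | h
    · simp only [d, h]
      exact log_le_two_mul_natLog hK
    · simp only [d, h]
      linarith
  let e : Fin d → X := fun k => (S.equivFin.symm (Fin.castLE (min_le_right _ _) k) : X)
  have he : Function.Injective e := Subtype.val_injective.comp
    (S.equivFin.symm.injective.comp (Fin.castLE_injective _))
  have heS : ∀ k, e k ∈ S := fun k => (S.equivFin.symm _).2
  choose p hp q hq hpq using fun k => exists_sum_sqrt_ge 𝒦 hγ (hab (e k) (heS k)).2
  let n := ⌈1 / (8 * γ)⌉₊
  have hn0 : 0 < n := Nat.ceil_pos.2 (by positivity)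
  have hn : ((n - 1 : ℕ) : ℝ) * (8 * γ) ≤ 1 := by
    rw [← le_div_iff₀ (by positivity), Nat.cast_sub hn0, Nat.cast_one]
    have := Nat.ceil_lt_add_one (a := 1 / (8 * γ)) (by positivity)
    linarith
  let C : Finset (X → Y) := Finset.univ.image (cubeHyp e a b)
  have hC : C.card ≤ K := by
    refine Finset.card_image_le.trans (le_of_eq_of_le ?_ hd2)
    simp
  -- The cube is padded with members of `𝒢` to reach size exactly `K`; enlarging the class keeps the
  -- lower bound.
  obtain ⟨ℋ, hCℋ, -, hℋ⟩ := Finset.exists_subsuperset_card_eq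
    (Finset.subset_union_left : C ⊆ C ∪ 𝒢) hC
    (h𝒢.symm.le.trans (Finset.card_le_card Finset.subset_union_right))
  refine ⟨ℋ, hℋ, fun T hT => ?_⟩
  refine le_trans ?_ (min_le_expectedRisk 𝒦 hγ hn0 hn he (fun k => (hab (e k) (heS k)).1) hp hq
    hpq (fun v => hCℋ (Finset.mem_image_of_mem _ (Finset.mem_univ v))) T)
  -- `d ≥ log K / 2` and `n ≥ 1 / (8 γ)` give the factor `1 / 16`; with `3 / 16` per round this is
  -- the constant `3 / 256`.
  have h1 : 1 / 16 * (Real.log K / γ) ≤ ((min T (d * n) : ℕ) : ℝ) := by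
    rw [Nat.cast_min]
    refine le_min ?_ ?_
    · have : 0 ≤ Real.log K / γ := by positivity
      linarith
    · have h2 : 1 / (8 * γ) ≤ n := Nat.le_ceil _
      have h3 : Real.log K / 2 * (1 / (8 * γ)) ≤ d * n :=
        mul_le_mul (by linarith) h2 (by positivity) (Nat.cast_nonneg d)
      rw [Nat.cast_mul]
      refine le_trans (le_of_eq ?_) h3
      field_simp
      ring
  linarith

end Lower

end NoisyOnline

theorem mainTheorem1 :
    (∀ (X Y Z : Type*) [Nonempty X] [Fintype Y] [Nontrivial Y] [Fintype Z] [Nontrivial Z]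
      (𝒦 : NoisyOnline.NoiseKernel X Y Z) (ℋ : Finset (X → Y)) (K T : ℕ) (γ δ : ℝ),
      (∀ x y, Convex ℝ (𝒦.dists x y)) → (∀ x y, IsClosed (𝒦.dists x y)) →
      1 ≤ K → ℋ.card = K →
      NoisyOnline.WellSeparated NoisyOnline.hellingerSq 𝒦 γ →
      0 < δ → δ ≤ 1 →
      NoisyOnline.highProbRisk ℋ 𝒦 T δ ≤
        8 * Real.log (4 * K / δ) * Real.log K / γ + Real.log (2 / δ)) ∧
    (∃ c : ℝ, 0 < c ∧
      ∀ (X Y Z : Type*) [Nonempty X] [Fintype Y] [Nontrivial Y] [Fintype Z] [Nontrivial Z]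
        (𝒦 : NoisyOnline.NoiseKernel X Y Z) (K : ℕ) (γ : ℝ),
        1 ≤ K → (∃ 𝒢 : Finset (X → Y), 𝒢.card = K) → 0 < γ →
        (∃ S : Finset X, Real.log K ≤ S.card ∧ ∀ x ∈ S, ∃ y y' : Y, y ≠ y' ∧
          NoisyOnline.setDiv NoisyOnline.hellingerSq (𝒦.dists x y) (𝒦.dists x y') ≤ γ) →
        ∃ ℋ : Finset (X → Y), ℋ.card = K ∧
          ∀ T : ℕ, Real.log K / γ ≤ T →
            c * (Real.log K / γ) ≤ NoisyOnline.expectedRisk ℋ 𝒦 T) := by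
  refine ⟨?_, 3 / 256, by norm_num, ?_⟩
  · intro X Y Z _ _ _ _ _ 𝒦 ℋ K T γ δ hconv hcl hK hcard hsep hδ hδ1
    subst hcard
    exact NoisyOnline.highProbRisk_le hconv hcl hsep hK T hδ hδ1
  · intro X Y Z _ _ _ _ _ 𝒦 K γ hK h𝒢 hγ hS
    exact NoisyOnline.exists_class_le_expectedRisk 𝒦 hK h𝒢 hγ hS
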